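/- Let $m>0$, and let $V_1,V_2:\mathbb{R}^3\to\mathbb{R}$ satisfy $(V_1)$: $V_i\in L^\infty_{\rm loc}(\mathbb{R}^3)$, $\lim_{|x|\to\infty}V_i(x)=\infty$ and $\inf_{x\in\mathbb{R}^3}V_i(x)=0$, for $i=1,2$. Write $\mathcal{F}u(\xi)=\int_{\mathbb{R}^3}e^{-2\pi i\xi\cdot x}u(x)\,dx$ for the ($L^2$-)Fourier transform, and let $H^{1/2}(\mathbb{R}^3)$ be the space of real-valued $u\in L^2(\mathbb{R}^3)$ with $\int_{\mathbb{R}^3}(1+2\pi|\xi|)|\mathcal{F}u(\xi)|^2d\xi<\infty$. For $u\in H^{1/2}(\mathbb{R}^3)$ put $$\|(-\Delta)^{1/4}u\|_2^2=\int_{\mathbb{R}^3}2\pi|\xi|\,|\mathcal{F}u(\xi)|^2d\xi,\quad (\sqrt{-\Delta+m^2}\,u,u)=\int_{\mathbb{R}^3}\sqrt{|2\pi\xi|^2+m^2}\,|\mathcal{F}u(\xi)|^2d\xi,\quad \phi_u(x)=\int_{\mathbb{R}^3}\frac{u(y)^2}{|x-y|}dy.$$ Let $\mathcal{M}$ be the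 set of pairs $(u_1,u_2)$ with $u_i\in H^{1/2}(\mathbb{R}^3)$, $\int_{\mathbb{R}^3} V_iu_i^2\,dx<\infty$ and $\int_{\mathbb{R}^3} u_i^2\,dx=1$ for $i=1,2$. For $a_1,a_2>0$ and $\beta\in\mathbb{R}$ let $$E_{a_1,a_2,\beta}(u_1,u_2)=\sum_{i=1}^2\Big[(\sqrt{-\Delta+m^2}\,u_i,u_i)+\int_{\mathbb{R}^3} V_iu_i^2\,dx-\frac{a_i}{2}\int_{\mathbb{R}^3}\phi_{u_i}u_i^2\,dx\Big]-\beta\int_{\mathbb{R}^3}\phi_{u_1}u_2^2\,dx,$$ $$\hat e(a_1,a_2,\beta)=\inf_{(u_1,u_2)\in\mathcal{M}}E_{a_1,a_2,\beta}(u_1,u_2)\in[-\infty,\infty),$$ and, with $\beta^+=\max\{0,\beta\}$, $$\eta(a_1,a_2,\beta)=\inf\left\{\frac{2\|(-\Delta)^{1/4}u_1\|_2^2+2\|(-\Delta)^{1/4}u_2\|_2^2}{a_1\int\phi_{u_1}u_1^2dx+a_2\int\phi_{u_2}u_2^2dx+2\beta^+\int\phi_{u_1}u_2^2dx}\;:\;u_i\in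 H^{1/2}(\mathbb{R}^3),\ \|u_i\|_2=1,\ i=1,2\right\}.$$ A minimizer of $\hat e(a_1,a_2,\beta)$ is a pair $(u_1,u_2)\in\mathcal{M}$ with $E_{a_1,a_2,\beta}(u_1,u_2)=\hat e(a_1,a_2,\beta)$. Then: (i) if $\eta(a_1,a_2,\beta)>1$, then $\hat e(a_1,a_2,\beta)$ has a minimizer; (ii) if $\eta(a_1,a_2,\beta)<1$, then $\hat e(a_1,a_2,\beta)$ has no minimizer. -/

import Mathlib

open MeasureTheory Filter
open scoped FourierTransform ENNReal

noncomputable section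

namespace PseudoHartree

/-- Euclidean space `ℝ³`. -/
abbrev R3 : Type := EuclideanSpace ℝ (Fin 3)

/-- The real Hilbert space `L²(ℝ³; ℝ)`. -/
abbrev L2 : Type := Lp ℝ 2 (volume : Measure R3)

/-- The Fourier (Plancherel) transform of a real `L²` function, normalized as
`∫ exp(-2πi ξ·x) u(x) dx`. -/
def fourierL2 (u : L2) : Lp ℂ 2 (volume : Measure R3) :=
  𝓕 (Complex.ofRealCLM.compLp u)

/-- Membership in the real Sobolev space `H^{1/2}(ℝ³)`:
`∫ (1 + 2π|ξ|) |𝓕u(ξ)|² dξ < ∞`. -/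
def MemHHalf (u : L2) : Prop :=
  Integrable (fun ξ : R3 => (1 + 2 * Real.pi * ‖ξ‖) * ‖fourierL2 u ξ‖ ^ 2)

/-- `‖(-Δ)^{1/4} u‖₂² = ∫ 2π|ξ| |𝓕u(ξ)|² dξ`. -/
def quarterLaplacianSq (u : L2) : ℝ :=
  ∫ ξ : R3, 2 * Real.pi * ‖ξ‖ * ‖fourierL2 u ξ‖ ^ 2

/-- `(√(-Δ + m²) u, u) = ∫ √(|2πξ|² + m²) |𝓕u(ξ)|² dξ`. -/
def kinetic (m : ℝ) (u : L2) : ℝ :=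
  ∫ ξ : R3, Real.sqrt ((2 * Real.pi * ‖ξ‖) ^ 2 + m ^ 2) * ‖fourierL2 u ξ‖ ^ 2

/-- `φ_u(x) = (|·|⁻¹ * u²)(x) = ∫ u(y)² / |x - y| dy`. -/
def phi (u : L2) (x : R3) : ℝ :=
  ∫ y : R3, u y ^ 2 / ‖x - y‖

/-- `∫ φ_u v² dx = ∬ u(y)² v(x)² / |x - y| dy dx`. -/
def coulomb (u v : L2) : ℝ :=
  ∫ x : R3, phi u x * v x ^ 2

/-- `∫ V u² dx`. -/
def potentialTerm (V : R3 → ℝ) (u : L2) : ℝ :=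
  ∫ x : R3, V x * u x ^ 2

/-- A trapping potential: `V ∈ L^∞_loc(ℝ³)`, `V(x) → ∞` as `|x| → ∞`, and `inf V = 0`. -/
structure IsTrapping (V : R3 → ℝ) : Prop where
  locBounded : ∀ K : Set R3, IsCompact K → MemLp V ∞ (volume.restrict K)
  tendsto_atTop : Tendsto V (cocompact R3) atTop
  inf_eq_zero : IsGLB (Set.range V) 0

/-- The space `{u ∈ H^{1/2}(ℝ³) : ∫ V u² < ∞}`. -/
def trapSpace (V : R3 → ℝ) : Set L2 :=
  {u | MemHHalf u ∧ Integrable (fun x : R3 => V x * u x ^ 2)}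

/-- The constraint set `ℳ`. -/
def constraintSet (V₁ V₂ : R3 → ℝ) : Set (L2 × L2) :=
  {w | w.1 ∈ trapSpace V₁ ∧ w.2 ∈ trapSpace V₂ ∧
    ∫ x : R3, w.1 x ^ 2 = 1 ∧ ∫ x : R3, w.2 x ^ 2 = 1}

/-- The energy `E_{a₁,a₂,β}(u₁,u₂)`. -/
def energy (m : ℝ) (V₁ V₂ : R3 → ℝ) (a₁ a₂ β : ℝ) (w : L2 × L2) : ℝ :=
  (kinetic m w.1 + potentialTerm V₁ w.1) + (kinetic m w.2 + potentialTerm V₂ w.2)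
    - (a₁ / 2 * coulomb w.1 w.1 + a₂ / 2 * coulomb w.2 w.2)
    - β * coulomb w.1 w.2

/-- The infimum `ê(a₁,a₂,β)`, extended-real valued since it may be `-∞`. -/
def eHat (m : ℝ) (V₁ V₂ : R3 → ℝ) (a₁ a₂ β : ℝ) : EReal :=
  ⨅ w ∈ constraintSet V₁ V₂, (energy m V₁ V₂ a₁ a₂ β w : EReal)

/-- `w` is a minimizer of `ê(a₁,a₂,β)`: it is admissible and attains the infimum. -/
def IsMinimizer (m : ℝ) (V₁ V₂ : R3 → ℝ) (a₁ a₂ β : ℝ) (w : L2 × L2) : Prop :=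
  w ∈ constraintSet V₁ V₂ ∧ (energy m V₁ V₂ a₁ a₂ β w : EReal) = eHat m V₁ V₂ a₁ a₂ β

/-- The quotient `J_{a₁,a₂,β}(u₁,u₂)`. -/
def quotientJ (a₁ a₂ β : ℝ) (w : L2 × L2) : ℝ :=
  (2 * quarterLaplacianSq w.1 + 2 * quarterLaplacianSq w.2) /
    (a₁ * coulomb w.1 w.1 + a₂ * coulomb w.2 w.2 + 2 * max 0 β * coulomb w.1 w.2)

/-- The set of pairs of `L²`-normalized functions in `H^{1/2}(ℝ³)`. -/
def normalizedPairs : Set (L2 × L2) :=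
  {w | MemHHalf w.1 ∧ MemHHalf w.2 ∧
    ∫ x : R3, w.1 x ^ 2 = 1 ∧ ∫ x : R3, w.2 x ^ 2 = 1}

/-- The auxiliary infimum `η(a₁,a₂,β)`. -/
def eta (a₁ a₂ β : ℝ) : EReal :=
  ⨅ w ∈ normalizedPairs, (quotientJ a₁ a₂ β w : EReal)

end PseudoHartree

end

/-!
For a normalized pair `(u₁, u₂)` put `Q = ‖(-Δ)^{1/4}u₁‖² + ‖(-Δ)^{1/4}u₂‖²` and let `D` be the
denominator of the quotient defining `η`. The symbol bounds `2π|ξ| ≤ √(|2πξ|² + m²) ≤ 2π|ξ| + |m|`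
show that `E` and `Q - D / 2` have the same behaviour at high frequencies, so everything is decided
by whether `2Q > D` holds with a uniform factor.

If `η > 1`, it does, and the energy is bounded below by a positive multiple of its nonnegative part.
A minimizing sequence is then bounded in `H^{1/2}` and tight, since the potentials tend to infinity;
by Rellich compactness a subsequence converges in `L²`. The quadratic part of the energy is lower
semicontinuous and the Coulomb terms converge, because Hardy's inequality
`∫ u(y)² / |x - y| dy ≤ C ‖(-Δ)^{1/4}u‖²` bounds the potentials `φ_u` uniformly.

If `η < 1`, some pair satisfies `2Q < D`, and by truncation it may be taken with bounded support.
Under the mass-preserving dilation `u ↦ t^{3/2} u(t ·)` both `Q` and `D` are multiplied by `t`,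
while the potential and mass terms stay bounded for `t ≥ 1`; hence the energy is unbounded below. If
`β < 0`, the cross term is absent from `D`, and one dilates a single component with
`2‖(-Δ)^{1/4}uᵢ‖² < aᵢ ∫ φ_{uᵢ} uᵢ²`, against which the cross term of the energy stays bounded.

The `H^{1/2}` energy is a multiple of the Gagliardo double integral
`∬ |u(x + h) - u(x)|² |h|⁻⁴ dx dh`, which unlike `∫ 2π|ξ| |𝓕u(ξ)|² dξ` can be localized and
truncated.
-/

noncomputable section

open Metric Module Topology

namespace PseudoHartree

section LpTwo

variable {α F : Type*} [MeasurableSpace α] {μ : Measure α} [NormedAddCommGroup F]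

theorem lintegral_norm_sq_coeFn (f : Lp F 2 μ) :
    ∫⁻ x, ENNReal.ofReal (‖f x‖ ^ 2) ∂μ = ENNReal.ofReal (‖f‖ ^ 2) := by
  have h := eLpNorm_nnreal_pow_eq_lintegral (f := f) (μ := μ) two_ne_zero
  simp only [NNReal.coe_ofNat, ENNReal.rpow_ofNat] at h
  simp only [ENNReal.ofReal_pow (norm_nonneg _), ofReal_norm]
  rw [← h, Lp.enorm_def]
  rfl

theorem integrable_norm_sq_coeFn (f : Lp F 2 μ) : Integrable (fun x => ‖f x‖ ^ 2) μ :=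
  (Lp.memLp f).integrable_norm_pow two_ne_zero

theorem integral_norm_sq_coeFn (f : Lp F 2 μ) : ∫ x, ‖f x‖ ^ 2 ∂μ = ‖f‖ ^ 2 := by
  rw [integral_eq_lintegral_of_nonneg_ae (Eventually.of_forall fun _ => sq_nonneg _)
    (integrable_norm_sq_coeFn f).aestronglyMeasurable, lintegral_norm_sq_coeFn,
    ENNReal.toReal_ofReal (sq_nonneg _)]

theorem integrable_sq_coeFn (f : Lp ℝ 2 μ) : Integrable (fun x => f x ^ 2) μ :=
  (Lp.memLp f).integrable_sq

theorem lintegral_sq_coeFn (f : Lp ℝ 2 μ) :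
    ∫⁻ x, ENNReal.ofReal (f x ^ 2) ∂μ = ENNReal.ofReal (‖f‖ ^ 2) := by
  simpa only [Real.norm_eq_abs, sq_abs] using lintegral_norm_sq_coeFn f

theorem integral_sq_coeFn (f : Lp ℝ 2 μ) : ∫ x, f x ^ 2 ∂μ = ‖f‖ ^ 2 := by
  simpa only [Real.norm_eq_abs, sq_abs] using integral_norm_sq_coeFn f

theorem measurable_coeFn (f : Lp ℝ 2 μ) : Measurable f :=
  (Lp.stronglyMeasurable f).measurable

theorem exists_subseq_tendsto_ae {u : ℕ → Lp F 2 μ} {u₀ : Lp F 2 μ}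
    (h : Tendsto u atTop (𝓝 u₀)) :
    ∃ σ : ℕ → ℕ, StrictMono σ ∧ ∀ᵐ x ∂μ, Tendsto (fun n => u (σ n) x) atTop (𝓝 (u₀ x)) :=
  (tendstoInMeasure_of_tendsto_Lp h).exists_seq_tendsto_ae

theorem norm_ofRealCLM_compLp (f : Lp ℝ 2 μ) : ‖Complex.ofRealCLM.compLp f‖ = ‖f‖ := by
  have h : ∀ᵐ x ∂μ, ‖Complex.ofRealCLM.compLp f x‖ = ‖f x‖ := by
    filter_upwards [Complex.ofRealCLM.coeFn_compLp f] with x hx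
    rw [hx, Complex.ofRealCLM_apply, Complex.norm_real]
  exact le_antisymm (Lp.norm_le_norm_of_ae_le (h.mono fun _ => le_of_eq))
    (Lp.norm_le_norm_of_ae_le (h.mono fun _ => ge_of_eq))

theorem integral_abs_sq_sub_sq_le (f g : Lp ℝ 2 μ) :
    ∫ x, |f x ^ 2 - g x ^ 2| ∂μ ≤ ‖f - g‖ * ‖f + g‖ := by
  have h : ∫ x, |f x ^ 2 - g x ^ 2| ∂μ = inner ℝ |f - g| |f + g| := by
    rw [L2.inner_def]
    refine integral_congr_ae ?_
    filter_upwards [Lp.coeFn_abs (f - g), Lp.coeFn_abs (f + g), Lp.coeFn_sub f g,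
      Lp.coeFn_add f g] with x h₁ h₂ h₃ h₄
    rw [h₁, h₂, h₃, h₄, Pi.sub_apply, Pi.add_apply, RCLike.inner_apply, conj_trivial, ← abs_mul,
      sq_sub_sq]
  rw [h, ← norm_abs_eq_norm (f - g), ← norm_abs_eq_norm (f + g)]
  exact real_inner_le_norm _ _

theorem tendsto_integral_abs_sq_sub_sq {ι : Type*} {l : Filter ι} {f : ι → Lp ℝ 2 μ}
    {g : Lp ℝ 2 μ} (h : Tendsto f l (𝓝 g)) :
    Tendsto (fun i => ∫ x, |f i x ^ 2 - g x ^ 2| ∂μ) l (𝓝 0) := by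
  have hmul : Tendsto (fun i => ‖f i - g‖ * ‖f i + g‖) l (𝓝 (‖g - g‖ * ‖g + g‖)) :=
    (h.sub_const g).norm.mul (h.add_const g).norm
  rw [sub_self, norm_zero, zero_mul] at hmul
  exact squeeze_zero (fun _ => integral_nonneg fun _ => abs_nonneg _)
    (fun i => integral_abs_sq_sub_sq_le (f i) g) hmul

end LpTwo

section Phase

variable {E : Type*} [NormedAddCommGroup E] [InnerProductSpace ℝ E]

/-- The character `ξ ↦ exp(2πi ⟨h, ξ⟩)`, the multiplier by which translation by `h` acts on the
Fourier side. -/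
def phase (h ξ : E) : ℂ := 𝐞 (inner ℝ h ξ)

theorem continuous_phase : Continuous fun p : E × E => phase p.1 p.2 := by
  unfold phase
  fun_prop

theorem norm_phase (h ξ : E) : ‖phase h ξ‖ = 1 := Circle.norm_coe _

theorem phase_zero_left (ξ : E) : phase 0 ξ = 1 := by simp [phase]

theorem phase_zero_right (h : E) : phase h 0 = 1 := by simp [phase]

theorem phase_smul_right (t : ℝ) (h ξ : E) : phase h (t • ξ) = phase (t • h) ξ := by
  simp only [phase, real_inner_smul_left, real_inner_smul_right]

theorem phase_map_map {G : Type*} [NormedAddCommGroup G] [InnerProductSpace ℝ G]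
    (A : E →ₗᵢ[ℝ] G) (h ξ : E) : phase (A h) (A ξ) = phase h ξ := by
  simp only [phase, A.inner_map_map]

theorem phase_half_smul_self {e : E} (he : ‖e‖ = 1) : phase ((1 / 2 : ℝ) • e) e = -1 := by
  have h : 2 * Real.pi * (1 / 2 * (1 : ℝ) ^ 2) = Real.pi := by ring
  rw [phase, real_inner_smul_left, real_inner_self_eq_norm_sq, he, Real.fourierChar_apply, h,
    Complex.exp_pi_mul_I]

theorem norm_phase_sub_one_le_two (h ξ : E) : ‖phase h ξ - 1‖ ≤ 2 :=
  (norm_sub_le _ _).trans (by rw [norm_phase, norm_one]; norm_num)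

theorem norm_phase_sub_one_le (h ξ : E) : ‖phase h ξ - 1‖ ≤ 2 * Real.pi * (‖h‖ * ‖ξ‖) := by
  rw [phase, Real.fourierChar_apply, mul_comm]
  refine Real.norm_exp_I_mul_ofReal_sub_one_le.trans ?_
  rw [norm_mul, Real.norm_of_nonneg Real.two_pi_pos.le]
  gcongr
  exact norm_inner_le_norm h ξ

end Phase

section Translation

variable {E : Type*} [NormedAddCommGroup E] [InnerProductSpace ℝ E] [FiniteDimensional ℝ E]
  [MeasurableSpace E] [BorelSpace E]
variable {F : Type*} [NormedAddCommGroup F] [InnerProductSpace ℂ F]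

/-- Translation `f ↦ f (· + h)` on `L²(E; F)`. -/
def translateL2 (h : E) : Lp F 2 (volume : Measure E) →ₗᵢ[ℂ] Lp F 2 (volume : Measure E) :=
  Lp.compMeasurePreservingₗᵢ ℂ (· + h) (measurePreserving_add_right volume h)

theorem coeFn_translateL2 (h : E) (f : Lp F 2 (volume : Measure E)) :
    translateL2 h f =ᵐ[volume] fun x => f (x + h) :=
  Lp.coeFn_compMeasurePreserving f (measurePreserving_add_right volume h)

theorem ae_comp_add_right {p : E → Prop} (hp : ∀ᵐ x, p x) (h : E) : ∀ᵐ x, p (x + h) :=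
  (measurePreserving_add_right volume h).quasiMeasurePreserving.ae hp

theorem memLp_phase (h : E) : MemLp (phase h) ∞ (volume : Measure E) :=
  memLp_top_of_bound (continuous_phase.comp (Continuous.prodMk_right h)).aestronglyMeasurable 1
    (Eventually.of_forall fun ξ => (norm_phase h ξ).le)

/-- Modulation `f ↦ phase h • f` on `L²(E; F)`. -/
def modulateL2 (h : E) : Lp F 2 (volume : Measure E) →L[ℂ] Lp F 2 (volume : Measure E) :=
  (ContinuousLinearMap.lsmul ℂ ℂ).holderL volume ∞ 2 2 ((memLp_phase h).toLp _)

theorem coeFn_modulateL2 (h : E) (f : Lp F 2 (volume : Measure E)) :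
    modulateL2 h f =ᵐ[volume] fun ξ => phase h ξ • f ξ := by
  filter_upwards [(ContinuousLinearMap.lsmul ℂ ℂ).coeFn_holder (r := 2)
    ((memLp_phase h).toLp _) f, (memLp_phase h).coeFn_toLp] with ξ hholder hphase
  rw [modulateL2, ContinuousLinearMap.holderL_apply_apply, hholder, hphase]
  rfl

theorem translateL2_toLp (h : E) (f : SchwartzMap E F) :
    translateL2 h (f.toLp 2) = (SchwartzMap.compSubConstCLM ℂ (-h) f).toLp 2 := by
  ext1
  filter_upwards [coeFn_translateL2 h (f.toLp 2),
    (SchwartzMap.compSubConstCLM ℂ (-h) f).coeFn_toLp 2,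
    ae_comp_add_right (f.coeFn_toLp 2 (volume : Measure E)) h] with x h₁ h₂ h₃
  rw [h₁, h₂, h₃, SchwartzMap.compSubConstCLM_apply, sub_neg_eq_add]

theorem fourier_compSubConstCLM_neg (h : E) (f : SchwartzMap E F) (ξ : E) :
    𝓕 (SchwartzMap.compSubConstCLM ℂ (-h) f) ξ = phase h ξ • 𝓕 f ξ := by
  have hcomp : (⇑(SchwartzMap.compSubConstCLM ℂ (-h) f) : E → F) = ⇑f ∘ (· + h) := by
    ext x
    rw [SchwartzMap.compSubConstCLM_apply, sub_neg_eq_add, Function.comp_apply]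
  rw [SchwartzMap.fourier_coe, SchwartzMap.fourier_coe, hcomp]
  exact congrFun (VectorFourier.fourierIntegral_comp_add_right 𝐞 volume (innerₗ E) f h) ξ

theorem fourier_translateL2 [CompleteSpace F] (h : E) (f : Lp F 2 (volume : Measure E)) :
    𝓕 (translateL2 h f) = modulateL2 h (𝓕 f) := by
  refine DenseRange.induction_on
    (p := fun f : Lp F 2 (volume : Measure E) => 𝓕 (translateL2 h f) = modulateL2 h (𝓕 f))
    (SchwartzMap.denseRange_toLpCLM (p := 2) (F := F) ENNReal.ofNat_ne_top) f ?_ fun g => ?_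
  · exact isClosed_eq
      ((Lp.fourierTransformₗᵢ E F).continuous.comp (translateL2 h).continuous)
      ((modulateL2 h).continuous.comp (Lp.fourierTransformₗᵢ E F).continuous)
  · rw [SchwartzMap.toLpCLM_apply, translateL2_toLp, SchwartzMap.toLp_fourier_eq,
      SchwartzMap.toLp_fourier_eq]
    ext1
    filter_upwards [coeFn_modulateL2 h ((𝓕 g).toLp 2), (𝓕 g).coeFn_toLp 2 (volume : Measure E),
      (𝓕 (SchwartzMap.compSubConstCLM ℂ (-h) g)).coeFn_toLp 2 (volume : Measure E)]
      with ξ h₁ h₂ h₃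
    rw [h₁, h₂, h₃, fourier_compSubConstCLM_neg]

theorem lintegral_norm_sq_translate_sub [CompleteSpace F] (f : Lp F 2 (volume : Measure E))
    (h : E) :
    ∫⁻ x, ENNReal.ofReal (‖f (x + h) - f x‖ ^ 2) =
      ∫⁻ ξ, ENNReal.ofReal (‖phase h ξ - 1‖ ^ 2 * ‖𝓕 f ξ‖ ^ 2) := by
  have hfourier : 𝓕 (translateL2 h f - f) = modulateL2 h (𝓕 f) - 𝓕 f := by
    rw [← fourier_translateL2]
    exact (Lp.fourierTransformₗᵢ E F).map_sub _ _
  calc ∫⁻ x, ENNReal.ofReal (‖f (x + h) - f x‖ ^ 2)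
      = ∫⁻ x, ENNReal.ofReal (‖(translateL2 h f - f) x‖ ^ 2) := by
        refine lintegral_congr_ae ?_
        filter_upwards [Lp.coeFn_sub (translateL2 h f) f, coeFn_translateL2 h f] with x h₁ h₂
        rw [h₁, Pi.sub_apply, h₂]
    _ = ∫⁻ ξ, ENNReal.ofReal (‖(modulateL2 h (𝓕 f) - 𝓕 f) ξ‖ ^ 2) := by
        rw [lintegral_norm_sq_coeFn, ← Lp.norm_fourier_eq, hfourier, lintegral_norm_sq_coeFn]
    _ = ∫⁻ ξ, ENNReal.ofReal (‖phase h ξ - 1‖ ^ 2 * ‖𝓕 f ξ‖ ^ 2) := by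
        refine lintegral_congr_ae ?_
        filter_upwards [Lp.coeFn_sub (modulateL2 h (𝓕 f)) (𝓕 f), coeFn_modulateL2 h (𝓕 f)]
          with ξ h₁ h₂
        rw [h₁, Pi.sub_apply, h₂, ← mul_pow, ← norm_smul, sub_smul, one_smul]

theorem lintegral_sq_translate_sub (u : Lp ℝ 2 (volume : Measure E)) (h : E) :
    ∫⁻ x, ENNReal.ofReal ((u (x + h) - u x) ^ 2) =
      ∫⁻ ξ, ENNReal.ofReal
        (‖phase h ξ - 1‖ ^ 2 * ‖𝓕 (Complex.ofRealCLM.compLp u : Lp ℂ 2 volume) ξ‖ ^ 2) := by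
  rw [← lintegral_norm_sq_translate_sub]
  refine lintegral_congr_ae ?_
  have hu := Complex.ofRealCLM.coeFn_compLp u
  filter_upwards [hu, ae_comp_add_right hu h] with x h₁ h₂
  rw [h₁, h₂, ← map_sub, Complex.ofRealCLM_apply, Complex.norm_real, Real.norm_eq_abs, sq_abs]

end Translation

section Gagliardo

variable {E : Type*} [NormedAddCommGroup E] [InnerProductSpace ℝ E] [FiniteDimensional ℝ E]
  [MeasurableSpace E] [BorelSpace E]

/-- The Gagliardo energy of order `1/2` of a real function on a `d`-dimensional Euclidean space,
`∬ |f(x + h) - f(x)|² |h|^(-d-1) dx dh`. On `L²` it is a multiple of `‖(-Δ)^{1/4} f‖₂²`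
(`gagliardo_eq_lintegral_fourier`), but it is defined for every function and transforms explicitly
under translations, dilations and products. -/
def gagliardo (f : E → ℝ) : ℝ≥0∞ :=
  ∫⁻ h, ∫⁻ x, ENNReal.ofReal ((f (x + h) - f x) ^ 2 / ‖h‖ ^ (finrank ℝ E + 1))

/-- The Fourier multiplier of the Gagliardo energy: `gagliardo u = ∫ gagliardoSymbol ξ |û(ξ)|² dξ`
for `u ∈ L²`. -/
def gagliardoSymbol (ξ : E) : ℝ≥0∞ :=
  ∫⁻ h, ENNReal.ofReal (‖phase h ξ - 1‖ ^ 2 / ‖h‖ ^ (finrank ℝ E + 1))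

theorem lintegral_comp_smul {V : Type*} [NormedAddCommGroup V] [NormedSpace ℝ V]
    [FiniteDimensional ℝ V] [MeasurableSpace V] [BorelSpace V] (μ : Measure V)
    [μ.IsAddHaarMeasure] (f : V → ℝ≥0∞) {t : ℝ} (ht : 0 < t) :
    ∫⁻ x, f (t • x) ∂μ = ENNReal.ofReal ((t ^ finrank ℝ V)⁻¹) * ∫⁻ x, f x ∂μ := by
  have hmap : ∫⁻ x, f x ∂(μ.map (t • ·)) = ∫⁻ x, f (t • x) ∂μ :=
    lintegral_map_equiv f (Homeomorph.smulOfNeZero t ht.ne').toMeasurableEquiv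
  rw [← hmap, Measure.map_addHaar_smul μ ht.ne', lintegral_smul_measure, abs_of_pos (by positivity),
    smul_eq_mul]

theorem gagliardoSymbol_zero : gagliardoSymbol (0 : E) = 0 := by
  simp [gagliardoSymbol, phase_zero_right]

theorem gagliardoSymbol_smul (ξ : E) {t : ℝ} (ht : 0 < t) :
    gagliardoSymbol (t • ξ) = ENNReal.ofReal t * gagliardoSymbol ξ := by
  have hscale (h : E) : ENNReal.ofReal (‖phase h (t • ξ) - 1‖ ^ 2 / ‖h‖ ^ (finrank ℝ E + 1)) =
      ENNReal.ofReal (t ^ (finrank ℝ E + 1)) *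
        ENNReal.ofReal (‖phase (t • h) ξ - 1‖ ^ 2 / ‖t • h‖ ^ (finrank ℝ E + 1)) := by
    rw [← ENNReal.ofReal_mul (by positivity), phase_smul_right, norm_smul,
      Real.norm_of_nonneg ht.le, mul_pow]
    congr 1
    field_simp
  simp_rw [gagliardoSymbol, hscale]
  rw [lintegral_const_mul' _ _ ENNReal.ofReal_ne_top, lintegral_comp_smul volume
    (fun h => ENNReal.ofReal (‖phase h ξ - 1‖ ^ 2 / ‖h‖ ^ (finrank ℝ E + 1))) ht,
    ← mul_assoc, ← ENNReal.ofReal_mul (by positivity)]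
  congr 2
  field_simp
  ring

theorem gagliardoSymbol_map (A : E ≃ₗᵢ[ℝ] E) (ξ : E) :
    gagliardoSymbol (A ξ) = gagliardoSymbol ξ := by
  rw [gagliardoSymbol, ← A.measurePreserving.lintegral_comp_emb A.toHomeomorph.measurableEmbedding]
  refine lintegral_congr fun h => ?_
  rw [A.norm_map, ← A.coe_toLinearIsometry, phase_map_map]

theorem gagliardoSymbol_eq_of_norm_eq {ξ η : E} (h : ‖ξ‖ = ‖η‖) :
    gagliardoSymbol ξ = gagliardoSymbol η := by
  rw [← gagliardoSymbol_map (Submodule.reflection (Submodule.span ℝ {ξ - η})ᗮ) ξ,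
    Submodule.reflection_sub h]

theorem integrable_min_one_sq_norm_div [Nontrivial E] :
    Integrable (fun h : E => min 1 (‖h‖ ^ 2) / ‖h‖ ^ (finrank ℝ E + 1)) := by
  rw [integrable_fun_norm_addHaar (volume : Measure E)
    (f := fun r => min 1 (r ^ 2) / r ^ (finrank ℝ E + 1))]
  obtain ⟨n, hn⟩ : ∃ n, finrank ℝ E = n + 1 := Nat.exists_eq_succ_of_ne_zero finrank_pos.ne'
  rw [hn, Nat.add_sub_cancel, ← Set.Ioc_union_Ioi_eq_Ioi zero_le_one]
  refine IntegrableOn.union ?_ ?_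
  · refine (integrableOn_const (C := (1 : ℝ)) (by simp)).congr_fun ?_ measurableSet_Ioc
    intro r hr
    have hr₀ : r ≠ 0 := hr.1.ne'
    simp only [min_eq_right (pow_le_one₀ hr.1.le hr.2), smul_eq_mul]
    field_simp
    ring
  · refine (integrableOn_Ioi_rpow_of_lt (a := -2) (by norm_num) one_pos).congr_fun ?_
      measurableSet_Ioi
    intro r hr
    have hr₁ : (1 : ℝ) < r := hr
    have hr₀ : 0 < r := one_pos.trans hr₁
    simp only [min_eq_left (one_le_pow₀ hr₁.le), smul_eq_mul, Real.rpow_neg hr₀.le,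
      Real.rpow_ofNat]
    field_simp
    ring

theorem gagliardoSymbol_ne_top {e : E} (he : ‖e‖ = 1) : gagliardoSymbol e ≠ ∞ := by
  have : Nontrivial E := ⟨e, 0, norm_ne_zero_iff.1 (he ▸ one_ne_zero)⟩
  have hdom := (integrable_min_one_sq_norm_div (E := E)).const_mul (4 * Real.pi ^ 2)
  refine ne_top_of_le_ne_top hdom.lintegral_lt_top.ne
    (lintegral_mono fun h => ENNReal.ofReal_le_ofReal ?_)
  rw [mul_div_assoc']
  gcongr
  have hlip : ‖phase h e - 1‖ ≤ 2 * Real.pi * ‖h‖ := by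
    simpa only [he, mul_one] using norm_phase_sub_one_le h e
  rw [mul_min_of_nonneg _ _ (by positivity), mul_one]
  refine le_min ?_ ?_
  · calc ‖phase h e - 1‖ ^ 2 ≤ (2 * 1) ^ 2 := by
          rw [mul_one]
          gcongr
          exact norm_phase_sub_one_le_two h e
      _ ≤ (2 * Real.pi) ^ 2 := by
          gcongr
          linarith [Real.pi_gt_three]
      _ = 4 * Real.pi ^ 2 := by ring
  · calc ‖phase h e - 1‖ ^ 2 ≤ (2 * Real.pi * ‖h‖) ^ 2 := by gcongr
      _ = 4 * Real.pi ^ 2 * ‖h‖ ^ 2 := by ring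

theorem gagliardoSymbol_ne_zero {e : E} (he : ‖e‖ = 1) : gagliardoSymbol e ≠ 0 := by
  have hcont : Continuous fun h : E => phase h e :=
    continuous_phase.comp (Continuous.prodMk_left e)
  have hmeas : Measurable fun h : E =>
      ENNReal.ofReal (‖phase h e - 1‖ ^ 2 / ‖h‖ ^ (finrank ℝ E + 1)) := by
    have := hcont.measurable
    fun_prop
  have hopen : IsOpen {h : E | phase h e ≠ 1} := isOpen_ne_fun hcont continuous_const
  have hne : {h : E | phase h e ≠ 1}.Nonempty := by
    refine ⟨(1 / 2 : ℝ) • e, ?_⟩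
    rw [Set.mem_ofPred_eq, phase_half_smul_self he]
    norm_num
  refine ((lintegral_pos_iff_support hmeas).2
    ((hopen.measure_pos volume hne).trans_le (measure_mono fun h hh => ?_))).ne'
  have hh₀ : 0 < ‖h‖ := norm_pos_iff.2 fun h₀ => hh (by rw [h₀, phase_zero_left])
  have hh₁ : 0 < ‖phase h e - 1‖ := norm_pos_iff.2 (sub_ne_zero.2 hh)
  rw [Function.mem_support, ne_eq, ENNReal.ofReal_eq_zero, not_le]
  positivity

-- By homogeneity and rotation invariance the symbol is determined by its value at a unit vector.
theorem exists_gagliardoSymbol_eq (E : Type*) [NormedAddCommGroup E] [InnerProductSpace ℝ E]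
    [FiniteDimensional ℝ E] [MeasurableSpace E] [BorelSpace E] [Nontrivial E] :
    ∃ c : ℝ, 0 < c ∧ ∀ ξ : E, gagliardoSymbol ξ = ENNReal.ofReal (c * (2 * Real.pi * ‖ξ‖)) := by
  obtain ⟨e, he⟩ : ∃ e : E, ‖e‖ = 1 := exists_norm_eq E zero_le_one
  have hpos := ENNReal.toReal_pos (gagliardoSymbol_ne_zero he) (gagliardoSymbol_ne_top he)
  refine ⟨(gagliardoSymbol e).toReal / (2 * Real.pi), by positivity, fun ξ => ?_⟩
  rcases eq_or_ne ξ 0 with rfl | hξ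
  · rw [gagliardoSymbol_zero, norm_zero, mul_zero, mul_zero, ENNReal.ofReal_zero]
  · have hnorm : ‖ξ‖ = ‖‖ξ‖ • e‖ := by rw [norm_smul, norm_norm, he, mul_one]
    rw [gagliardoSymbol_eq_of_norm_eq hnorm, gagliardoSymbol_smul e (norm_pos_iff.2 hξ),
      ← mul_assoc, div_mul_cancel₀ _ Real.two_pi_pos.ne', ENNReal.ofReal_mul hpos.le,
      ENNReal.ofReal_toReal (gagliardoSymbol_ne_top he), mul_comm]

/-- The ratio between the Gagliardo energy and `∫ 2π|ξ| |û(ξ)|² dξ`. -/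
def gagliardoConst (E : Type*) [NormedAddCommGroup E] [InnerProductSpace ℝ E]
    [FiniteDimensional ℝ E] [MeasurableSpace E] [BorelSpace E] [Nontrivial E] : ℝ :=
  (exists_gagliardoSymbol_eq E).choose

theorem gagliardoConst_pos [Nontrivial E] : 0 < gagliardoConst E :=
  (exists_gagliardoSymbol_eq E).choose_spec.1

theorem gagliardoSymbol_eq [Nontrivial E] (ξ : E) :
    gagliardoSymbol ξ = ENNReal.ofReal (gagliardoConst E * (2 * Real.pi * ‖ξ‖)) :=
  (exists_gagliardoSymbol_eq E).choose_spec.2 ξ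

theorem gagliardo_eq_lintegral_fourier [Nontrivial E] (u : Lp ℝ 2 (volume : Measure E)) :
    gagliardo u = ENNReal.ofReal (gagliardoConst E) * ∫⁻ ξ, ENNReal.ofReal
      (2 * Real.pi * ‖ξ‖ * ‖𝓕 (Complex.ofRealCLM.compLp u : Lp ℂ 2 volume) ξ‖ ^ 2) := by
  set g : Lp ℂ 2 (volume : Measure E) := 𝓕 (Complex.ofRealCLM.compLp u)
  have hmeas : Measurable g := (Lp.stronglyMeasurable _).measurable
  have hphase : Measurable fun p : E × E => phase p.1 p.2 := continuous_phase.measurable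
  have hw (h ξ : E) : 0 ≤ ‖phase h ξ - 1‖ ^ 2 / ‖h‖ ^ (finrank ℝ E + 1) := by positivity
  calc gagliardo u = ∫⁻ h : E, ∫⁻ ξ, ENNReal.ofReal
        (‖phase h ξ - 1‖ ^ 2 / ‖h‖ ^ (finrank ℝ E + 1) * ‖g ξ‖ ^ 2) := by
        refine lintegral_congr fun h => ?_
        have hnn : 0 ≤ (‖h‖ ^ (finrank ℝ E + 1))⁻¹ := by positivity
        simp_rw [div_eq_inv_mul, mul_assoc, ENNReal.ofReal_mul hnn]
        rw [lintegral_const_mul' _ _ ENNReal.ofReal_ne_top,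
          lintegral_const_mul' _ _ ENNReal.ofReal_ne_top, lintegral_sq_translate_sub]
    _ = ∫⁻ ξ, ∫⁻ h : E, ENNReal.ofReal
        (‖phase h ξ - 1‖ ^ 2 / ‖h‖ ^ (finrank ℝ E + 1) * ‖g ξ‖ ^ 2) := by
        refine lintegral_lintegral_swap (Measurable.aemeasurable ?_)
        simp only [Function.uncurry_def]
        fun_prop
    _ = ∫⁻ ξ, ENNReal.ofReal (gagliardoConst E) *
        ENNReal.ofReal (2 * Real.pi * ‖ξ‖ * ‖g ξ‖ ^ 2) := by
        refine lintegral_congr fun ξ => ?_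
        simp_rw [ENNReal.ofReal_mul (hw _ ξ)]
        rw [lintegral_mul_const' _ _ ENNReal.ofReal_ne_top, ← gagliardoSymbol, gagliardoSymbol_eq,
          ENNReal.ofReal_mul gagliardoConst_pos.le, mul_assoc, ← ENNReal.ofReal_mul (by positivity)]
    _ = _ := lintegral_const_mul' _ _ ENNReal.ofReal_ne_top

theorem gagliardo_eq_lintegral_prod {f : E → ℝ} (hf : Measurable f) :
    gagliardo f = ∫⁻ p : E × E, ENNReal.ofReal
      ((f (p.2 + p.1) - f p.2) ^ 2 / ‖p.1‖ ^ (finrank ℝ E + 1)) := by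
  rw [Measure.volume_eq_prod, lintegral_prod _ (Measurable.aemeasurable (by fun_prop)), gagliardo]

theorem gagliardo_eq_lintegral_sub {f : E → ℝ} (hf : Measurable f) :
    gagliardo f = ∫⁻ x, ∫⁻ y, ENNReal.ofReal
      ((f y - f x) ^ 2 / ‖y - x‖ ^ (finrank ℝ E + 1)) := by
  rw [gagliardo, lintegral_lintegral_swap]
  · refine lintegral_congr fun x => ?_
    rw [← lintegral_add_left_eq_self
      (fun y => ENNReal.ofReal ((f y - f x) ^ 2 / ‖y - x‖ ^ (finrank ℝ E + 1))) x]
    simp only [add_sub_cancel_left]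
  · refine Measurable.aemeasurable ?_
    simp only [Function.uncurry_def]
    fun_prop

theorem gagliardo_congr_ae {f g : E → ℝ} (h : f =ᵐ[volume] g) : gagliardo f = gagliardo g := by
  refine lintegral_congr fun z => lintegral_congr_ae ?_
  filter_upwards [h, ae_comp_add_right h z] with x h₁ h₂
  rw [h₁, h₂]

theorem gagliardo_comp_add (f : E → ℝ) (a : E) : gagliardo (fun x => f (x + a)) = gagliardo f := by
  refine lintegral_congr fun h => ?_
  rw [← lintegral_add_right_eq_self
    (fun x => ENNReal.ofReal ((f (x + h) - f x) ^ 2 / ‖h‖ ^ (finrank ℝ E + 1))) a]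
  simp only [add_right_comm]

theorem gagliardo_const_mul (c : ℝ) (f : E → ℝ) :
    gagliardo (fun x => c * f x) = ENNReal.ofReal (c ^ 2) * gagliardo f := by
  have hfactor (h x : E) :
      ENNReal.ofReal ((c * f (x + h) - c * f x) ^ 2 / ‖h‖ ^ (finrank ℝ E + 1)) =
        ENNReal.ofReal (c ^ 2) *
          ENNReal.ofReal ((f (x + h) - f x) ^ 2 / ‖h‖ ^ (finrank ℝ E + 1)) := by
    rw [← ENNReal.ofReal_mul (sq_nonneg c), ← mul_sub, mul_pow, mul_div_assoc]
  simp_rw [gagliardo, hfactor, lintegral_const_mul' _ _ ENNReal.ofReal_ne_top]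

theorem gagliardo_comp_smul (f : E → ℝ) {t : ℝ} (ht : 0 < t) :
    ENNReal.ofReal (t ^ finrank ℝ E) * gagliardo (fun x => f (t • x)) =
      ENNReal.ofReal t * gagliardo f := by
  have hscale (h x : E) :
      ENNReal.ofReal ((f (t • (x + h)) - f (t • x)) ^ 2 / ‖h‖ ^ (finrank ℝ E + 1)) =
        ENNReal.ofReal (t ^ (finrank ℝ E + 1)) * ENNReal.ofReal
          ((f (t • x + t • h) - f (t • x)) ^ 2 / ‖t • h‖ ^ (finrank ℝ E + 1)) := by
    rw [← ENNReal.ofReal_mul (by positivity), smul_add, norm_smul, Real.norm_of_nonneg ht.le,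
      mul_pow]
    congr 1
    field_simp
  simp_rw [gagliardo, hscale, lintegral_const_mul' _ _ ENNReal.ofReal_ne_top]
  simp_rw [fun h : E => lintegral_comp_smul volume (fun x => ENNReal.ofReal
    ((f (x + t • h) - f x) ^ 2 / ‖t • h‖ ^ (finrank ℝ E + 1))) ht,
    lintegral_const_mul' _ _ ENNReal.ofReal_ne_top]
  rw [lintegral_comp_smul volume (fun h => ∫⁻ x, ENNReal.ofReal
    ((f (x + h) - f x) ^ 2 / ‖h‖ ^ (finrank ℝ E + 1))) ht]
  simp only [← mul_assoc]
  rw [← ENNReal.ofReal_mul (by positivity), ← ENNReal.ofReal_mul (by positivity),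
    ← ENNReal.ofReal_mul (by positivity)]
  congr 2
  field_simp
  ring

theorem gagliardo_sub_le {f : E → ℝ} (hf : Measurable f) (g : E → ℝ) :
    gagliardo (fun x => f x - g x) ≤ 2 * gagliardo f + 2 * gagliardo g := by
  have hpoint (h x : E) :
      ENNReal.ofReal ((f (x + h) - g (x + h) - (f x - g x)) ^ 2 / ‖h‖ ^ (finrank ℝ E + 1)) ≤
        2 * ENNReal.ofReal ((f (x + h) - f x) ^ 2 / ‖h‖ ^ (finrank ℝ E + 1)) +
          2 * ENNReal.ofReal ((g (x + h) - g x) ^ 2 / ‖h‖ ^ (finrank ℝ E + 1)) := by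
    rw [← ENNReal.ofReal_ofNat 2, ← ENNReal.ofReal_mul zero_le_two,
      ← ENNReal.ofReal_mul zero_le_two, ← ENNReal.ofReal_add (by positivity) (by positivity)]
    refine ENNReal.ofReal_le_ofReal ?_
    rw [← mul_div_assoc, ← mul_div_assoc, ← add_div]
    gcongr
    nlinarith [sq_nonneg (f (x + h) - f x + (g (x + h) - g x))]
  have hinner (h : E) : Measurable fun x =>
      2 * ENNReal.ofReal ((f (x + h) - f x) ^ 2 / ‖h‖ ^ (finrank ℝ E + 1)) := by fun_prop
  have houter : Measurable fun h : E => 2 * ∫⁻ x, ENNReal.ofReal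
      ((f (x + h) - f x) ^ 2 / ‖h‖ ^ (finrank ℝ E + 1)) := by fun_prop
  refine (lintegral_mono fun h => (lintegral_mono (hpoint h)).trans_eq <|
    lintegral_add_left (hinner h) _).trans_eq ?_
  simp_rw [lintegral_const_mul' _ _ ENNReal.ofNat_ne_top]
  rw [lintegral_add_left houter, lintegral_const_mul' _ _ ENNReal.ofNat_ne_top,
    lintegral_const_mul' _ _ ENNReal.ofNat_ne_top, gagliardo, gagliardo]

theorem gagliardo_coeFn_sub_le (u v : Lp ℝ 2 (volume : Measure E)) :
    gagliardo ⇑(u - v) ≤ 2 * gagliardo u + 2 * gagliardo v :=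
  (gagliardo_congr_ae (Lp.coeFn_sub u v)).trans_le (gagliardo_sub_le (measurable_coeFn u) v)

theorem gagliardo_coeFn_smul (c : ℝ) (u : Lp ℝ 2 (volume : Measure E)) :
    gagliardo ⇑(c • u) = ENNReal.ofReal (c ^ 2) * gagliardo u :=
  (gagliardo_congr_ae (Lp.coeFn_smul c u)).trans (gagliardo_const_mul c u)

end Gagliardo

section Hardy

variable {E : Type*} [NormedAddCommGroup E] [InnerProductSpace ℝ E] [FiniteDimensional ℝ E]
  [MeasurableSpace E] [BorelSpace E]

theorem setLIntegral_sq_sub_le (f : E → ℝ) {s : Set E} {x : E} {R : ℝ} (hs : s ⊆ closedBall x R) :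
    ∫⁻ y in s, ENNReal.ofReal ((f y - f x) ^ 2) ≤ ENNReal.ofReal (R ^ (finrank ℝ E + 1)) *
      ∫⁻ y, ENNReal.ofReal ((f y - f x) ^ 2 / ‖y - x‖ ^ (finrank ℝ E + 1)) := by
  rw [← lintegral_const_mul' _ _ ENNReal.ofReal_ne_top]
  refine (lintegral_mono_set hs).trans ((setLIntegral_mono' measurableSet_closedBall
    fun y hy => ?_).trans (setLIntegral_le_lintegral _ _))
  have hyR : ‖y - x‖ ≤ R := mem_closedBall_iff_norm.1 hy
  have hR : 0 ≤ R := (norm_nonneg _).trans hyR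
  rw [← ENNReal.ofReal_mul (by positivity)]
  refine ENNReal.ofReal_le_ofReal ?_
  rcases eq_or_ne y x with rfl | hne
  · simp
  · have hpos : 0 < ‖y - x‖ := norm_sub_pos_iff.2 hne
    rw [mul_div_assoc', le_div_iff₀ (by positivity), mul_comm]
    gcongr

theorem measure_mul_sq_le {f : E → ℝ} (hf : Measurable f) {s : Set E} {x : E} {R : ℝ}
    (hs : s ⊆ closedBall x R) :
    volume s * ENNReal.ofReal (f x ^ 2) ≤ 2 * (∫⁻ y in s, ENNReal.ofReal (f y ^ 2)) +
      2 * (ENNReal.ofReal (R ^ (finrank ℝ E + 1)) *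
        ∫⁻ y, ENNReal.ofReal ((f y - f x) ^ 2 / ‖y - x‖ ^ (finrank ℝ E + 1))) := by
  have hpoint (y : E) : ENNReal.ofReal (f x ^ 2) ≤
      2 * ENNReal.ofReal (f y ^ 2) + 2 * ENNReal.ofReal ((f y - f x) ^ 2) := by
    rw [← ENNReal.ofReal_ofNat 2, ← ENNReal.ofReal_mul zero_le_two,
      ← ENNReal.ofReal_mul zero_le_two, ← ENNReal.ofReal_add (by positivity) (by positivity)]
    exact ENNReal.ofReal_le_ofReal (by nlinarith [sq_nonneg (2 * f y - f x)])
  have hmeas : Measurable fun y => 2 * ENNReal.ofReal (f y ^ 2) := by fun_prop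
  calc volume s * ENNReal.ofReal (f x ^ 2) = ∫⁻ _ in s, ENNReal.ofReal (f x ^ 2) := by
        rw [setLIntegral_const, mul_comm]
    _ ≤ ∫⁻ y in s, (2 * ENNReal.ofReal (f y ^ 2) + 2 * ENNReal.ofReal ((f y - f x) ^ 2)) :=
        lintegral_mono hpoint
    _ = 2 * (∫⁻ y in s, ENNReal.ofReal (f y ^ 2)) +
        2 * ∫⁻ y in s, ENNReal.ofReal ((f y - f x) ^ 2) := by
        rw [lintegral_add_left hmeas, lintegral_const_mul' _ _ ENNReal.ofNat_ne_top,
          lintegral_const_mul' _ _ ENNReal.ofNat_ne_top]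
    _ ≤ _ := by
        gcongr
        exact setLIntegral_sq_sub_le f hs

theorem norm_bounds_of_mem_ball_smul {F : Type*} [NormedAddCommGroup F] [NormedSpace ℝ F] {x y : F}
    (h : y ∈ ball ((8 : ℝ) • x) ‖x‖) :
    7 * ‖x‖ ≤ ‖y‖ ∧ ‖y‖ ≤ 9 * ‖x‖ ∧ ‖y - x‖ ≤ 8 * ‖x‖ ∧ x ∈ ball ((1 / 8 : ℝ) • y) (‖y‖ / 56) := by
  rw [mem_ball_iff_norm] at h
  have h₈ : ‖(8 : ℝ) • x‖ = 8 * ‖x‖ := by rw [norm_smul, Real.norm_ofNat]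
  have h₇ : ‖(7 : ℝ) • x‖ = 7 * ‖x‖ := by rw [norm_smul, Real.norm_ofNat]
  have hlower : 7 * ‖x‖ ≤ ‖y‖ := by
    linarith [norm_sub_norm_le ((8 : ℝ) • x) y, norm_sub_rev ((8 : ℝ) • x) y]
  refine ⟨hlower, by linarith [norm_sub_norm_le y ((8 : ℝ) • x)], ?_, ?_⟩
  · calc ‖y - x‖ = ‖(y - (8 : ℝ) • x) + (7 : ℝ) • x‖ := by congr 1; module
      _ ≤ 8 * ‖x‖ := by linarith [norm_add_le (y - (8 : ℝ) • x) ((7 : ℝ) • x)]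
  · have hrev : x - (1 / 8 : ℝ) • y = (-(1 / 8) : ℝ) • (y - (8 : ℝ) • x) := by module
    rw [mem_ball_iff_norm, hrev, norm_smul]
    norm_num
    linarith

-- Compares `f x` with the values of `f` on the ball of centre `8x` and radius `|x|`.
theorem volume_mul_sq_div_norm_le {f : E → ℝ} (hf : Measurable f) {x : E} (hx : x ≠ 0) :
    volume (ball (0 : E) 1) * ENNReal.ofReal (f x ^ 2 / ‖x‖) ≤
      2 * (∫⁻ y in ball ((8 : ℝ) • x) ‖x‖, ENNReal.ofReal (f y ^ 2 / ‖x‖ ^ (finrank ℝ E + 1))) +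
      2 * (8 ^ (finrank ℝ E + 1) *
        ∫⁻ y, ENNReal.ofReal ((f y - f x) ^ 2 / ‖y - x‖ ^ (finrank ℝ E + 1))) := by
  have hx₀ : 0 < ‖x‖ := norm_pos_iff.2 hx
  set c : ℝ≥0∞ := ENNReal.ofReal ((‖x‖ ^ (finrank ℝ E + 1))⁻¹) with hc
  have hscale := mul_le_mul_right (measure_mul_sq_le hf fun y hy =>
    mem_closedBall_iff_norm.2 (norm_bounds_of_mem_ball_smul (x := x) hy).2.2.1) c
  have hleft : c * (volume (ball ((8 : ℝ) • x) ‖x‖) * ENNReal.ofReal (f x ^ 2)) =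
      volume (ball (0 : E) 1) * ENNReal.ofReal (f x ^ 2 / ‖x‖) := by
    rw [Measure.addHaar_ball_of_pos _ _ hx₀, hc, mul_right_comm, mul_comm (volume _), ← mul_assoc,
      ← ENNReal.ofReal_mul (by positivity), ← ENNReal.ofReal_mul (by positivity)]
    congr 2
    field_simp
    ring
  have hright : c * ENNReal.ofReal ((8 * ‖x‖) ^ (finrank ℝ E + 1)) = 8 ^ (finrank ℝ E + 1) := by
    rw [hc, ← ENNReal.ofReal_mul (by positivity), mul_pow, inv_mul_eq_div,
      mul_div_cancel_right₀ _ (by positivity), ENNReal.ofReal_pow (by norm_num),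
      ENNReal.ofReal_ofNat]
  rw [hleft, mul_add, mul_left_comm c 2, mul_left_comm c 2, ← mul_assoc c (ENNReal.ofReal _),
    hright, ← lintegral_const_mul' _ _ ENNReal.ofReal_ne_top] at hscale
  simpa only [hc, ← ENNReal.ofReal_mul (inv_nonneg.2 (pow_nonneg (norm_nonneg x) _)),
    ← div_eq_inv_mul] using hscale

theorem nine_pow_succ_div_le {d : ℕ} (hd : 2 ≤ d) : (9 : ℝ) ^ (d + 1) / 56 ^ d ≤ 1 / 4 := by
  obtain ⟨k, rfl⟩ := Nat.exists_eq_add_of_le hd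
  calc (9 : ℝ) ^ (2 + k + 1) / 56 ^ (2 + k) = 9 ^ 3 / 56 ^ 2 * (9 / 56) ^ k := by
        rw [div_pow, pow_add, pow_add, pow_add]
        ring
    _ ≤ 9 ^ 3 / 56 ^ 2 * 1 := by
        gcongr
        exact pow_le_one₀ (by norm_num) (by norm_num)
    _ ≤ 1 / 4 := by norm_num

theorem setLIntegral_div_norm_pow_le (hd : 2 ≤ finrank ℝ E) {c : ℝ} (hc : 0 ≤ c) (y : E) :
    ∫⁻ x in {x | y ∈ ball ((8 : ℝ) • x) ‖x‖}, ENNReal.ofReal (c / ‖x‖ ^ (finrank ℝ E + 1)) ≤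
      4⁻¹ * (volume (ball (0 : E) 1) * ENNReal.ofReal (c / ‖y‖)) := by
  have hmeas : MeasurableSet {x : E | dist y ((8 : ℝ) • x) < ‖x‖} :=
    measurableSet_lt (by fun_prop) (by fun_prop)
  rcases eq_or_ne y 0 with rfl | hy
  · have hempty : {x : E | (0 : E) ∈ ball ((8 : ℝ) • x) ‖x‖} = ∅ := by
      refine Set.eq_empty_of_forall_notMem fun x hx => ?_
      have hle := (norm_bounds_of_mem_ball_smul hx).1
      linarith [pos_of_mem_ball hx, norm_zero (E := E)]
    rw [hempty, Measure.restrict_empty, lintegral_zero_measure]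
    exact zero_le
  calc _ ≤ ∫⁻ _ in {x : E | y ∈ ball ((8 : ℝ) • x) ‖x‖},
        ENNReal.ofReal (c * 9 ^ (finrank ℝ E + 1) / ‖y‖ ^ (finrank ℝ E + 1)) := by
        refine setLIntegral_mono' hmeas fun x hx => ENNReal.ofReal_le_ofReal ?_
        have hx₀ : 0 < ‖x‖ := pos_of_mem_ball hx
        rw [div_le_div_iff₀ (by positivity) (by positivity), mul_assoc, ← mul_pow]
        gcongr
        exact (norm_bounds_of_mem_ball_smul hx).2.1
    _ ≤ ∫⁻ _ in ball ((1 / 8 : ℝ) • y) (‖y‖ / 56),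
        ENNReal.ofReal (c * 9 ^ (finrank ℝ E + 1) / ‖y‖ ^ (finrank ℝ E + 1)) :=
        lintegral_mono_set fun x hx => (norm_bounds_of_mem_ball_smul hx).2.2.2
    _ = ENNReal.ofReal (9 ^ (finrank ℝ E + 1) / 56 ^ finrank ℝ E) *
        (volume (ball (0 : E) 1) * ENNReal.ofReal (c / ‖y‖)) := by
        rw [setLIntegral_const, Measure.addHaar_ball_of_pos _ _ (by positivity), ← mul_assoc,
          ← ENNReal.ofReal_mul (by positivity), mul_comm (volume _), ← mul_assoc,
          ← ENNReal.ofReal_mul (by positivity)]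
        congr 2
        rw [div_pow]
        field_simp
        ring
    _ ≤ _ := by
        gcongr
        rw [← ENNReal.ofReal_ofNat 4, ← ENNReal.ofReal_inv_of_pos four_pos, ← one_div]
        exact ENNReal.ofReal_le_ofReal (nine_pow_succ_div_le hd)

theorem lintegral_lintegral_ball_le (hd : 2 ≤ finrank ℝ E) {f : E → ℝ} (hf : Measurable f) (ε : ℝ) :
    ∫⁻ x in {x | ε < ‖x‖}, ∫⁻ y in ball ((8 : ℝ) • x) ‖x‖,
        ENNReal.ofReal (f y ^ 2 / ‖x‖ ^ (finrank ℝ E + 1)) ≤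
      4⁻¹ * (volume (ball (0 : E) 1) *
        ∫⁻ y in {y | ε < ‖y‖}, ENNReal.ofReal (f y ^ 2 / ‖y‖)) := by
  set S : Set E := {x | ε < ‖x‖}
  set k : E → E → ℝ≥0∞ := fun x y => ENNReal.ofReal (f y ^ 2 / ‖x‖ ^ (finrank ℝ E + 1))
  have hS : MeasurableSet S := measurableSet_lt measurable_const measurable_norm
  have hT : MeasurableSet {p : E × E | dist p.2 ((8 : ℝ) • p.1) < ‖p.1‖} :=
    measurableSet_lt (by fun_prop) (by fun_prop)
  have hTy (y : E) : MeasurableSet {x : E | y ∈ ball ((8 : ℝ) • x) ‖x‖} :=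
    measurable_prodMk_right hT
  have hmeas : Measurable (Function.uncurry fun x y =>
      (ball ((8 : ℝ) • x) ‖x‖).indicator (k x) y) :=
    Measurable.indicator (f := Function.uncurry k) (by simp only [k]; fun_prop) hT
  calc _ = ∫⁻ x in S, ∫⁻ y, (ball ((8 : ℝ) • x) ‖x‖).indicator (k x) y :=
        lintegral_congr fun x => (lintegral_indicator measurableSet_ball _).symm
    _ = ∫⁻ y, ∫⁻ x in S, (ball ((8 : ℝ) • x) ‖x‖).indicator (k x) y :=
        lintegral_lintegral_swap hmeas.aemeasurable
    _ ≤ ∫⁻ y, S.indicator (fun y => 4⁻¹ * (volume (ball (0 : E) 1) *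
        ENNReal.ofReal (f y ^ 2 / ‖y‖))) y := by
        refine lintegral_mono fun y => ?_
        by_cases hy : y ∈ S
        · rw [Set.indicator_of_mem hy]
          refine (setLIntegral_le_lintegral _ _).trans (le_trans (le_of_eq ?_)
            (setLIntegral_div_norm_pow_le hd (sq_nonneg (f y)) y))
          rw [← lintegral_indicator (hTy y)]
          rfl
        · rw [Set.indicator_of_notMem hy]
          refine (setLIntegral_eq_zero hS fun x hx => ?_).le
          refine Set.indicator_of_notMem (fun hyx => hy ?_) _
          have hx : ε < ‖x‖ := hx
          change ε < ‖y‖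
          linarith [(norm_bounds_of_mem_ball_smul hyx).1, norm_nonneg x]
    _ = _ := by
        rw [lintegral_indicator hS, lintegral_const_mul' _ _ (by simp),
          lintegral_const_mul' _ _ measure_ball_lt_top.ne]

theorem setLIntegral_sq_div_norm_ne_top {f : E → ℝ} (hf : ∫⁻ x, ENNReal.ofReal (f x ^ 2) ≠ ∞)
    {ε : ℝ} (hε : 0 < ε) :
    ∫⁻ x in {x | ε < ‖x‖}, ENNReal.ofReal (f x ^ 2 / ‖x‖) ≠ ∞ := by
  have hS : MeasurableSet {x : E | ε < ‖x‖} := measurableSet_lt measurable_const measurable_norm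
  refine ne_top_of_le_ne_top (ENNReal.mul_ne_top (ENNReal.ofReal_ne_top (r := ε⁻¹)) hf) ?_
  rw [← lintegral_const_mul' _ _ ENNReal.ofReal_ne_top]
  refine (setLIntegral_mono' hS fun x hx => ?_).trans (setLIntegral_le_lintegral _ _)
  rw [← ENNReal.ofReal_mul (by positivity), div_eq_inv_mul]
  gcongr
  exact le_of_lt hx

/-- The constant in the fractional Hardy inequality `lintegral_sq_div_norm_sub_le`. -/
def hardyConst (E : Type*) [NormedAddCommGroup E] [InnerProductSpace ℝ E]
    [MeasureSpace E] : ℝ≥0∞ :=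
  4 * 8 ^ (finrank ℝ E + 1) / volume (ball (0 : E) 1)

theorem le_two_mul_of_le_half_add {a b : ℝ≥0∞} (ha : a ≠ ∞)
    (h : a ≤ 2 * (4⁻¹ * a) + b) : a ≤ 2 * b := by
  lift a to NNReal using ha
  rcases eq_or_ne b ∞ with rfl | hb
  · simp
  lift b to NNReal using hb
  rw [show (4⁻¹ : ℝ≥0∞) = ((4⁻¹ : NNReal) : ℝ≥0∞) by simp] at h
  norm_cast at h ⊢
  rw [← NNReal.coe_le_coe] at h ⊢
  push_cast at h ⊢
  linarith

theorem setLIntegral_sq_div_norm_le (hd : 2 ≤ finrank ℝ E) {f : E → ℝ} (hf : Measurable f)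
    (hf₂ : ∫⁻ x, ENNReal.ofReal (f x ^ 2) ≠ ∞) {ε : ℝ} (hε : 0 < ε) :
    ∫⁻ x in {x | ε < ‖x‖}, ENNReal.ofReal (f x ^ 2 / ‖x‖) ≤ hardyConst E * gagliardo f := by
  set S : Set E := {x | ε < ‖x‖}
  set ω := volume (ball (0 : E) 1)
  set N := ∫⁻ x in S, ENNReal.ofReal (f x ^ 2 / ‖x‖)
  have hS : MeasurableSet S := measurableSet_lt measurable_const measurable_norm
  have hω : ω ≠ ∞ := measure_ball_lt_top.ne
  have hω₀ : ω ≠ 0 := (measure_ball_pos _ _ one_pos).ne'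
  have habsorb : ω * N ≤ 2 * (4⁻¹ * (ω * N)) + 2 * (8 ^ (finrank ℝ E + 1) * gagliardo f) := by
    have hmeas : Measurable fun x => 8 ^ (finrank ℝ E + 1) *
      ∫⁻ y, ENNReal.ofReal ((f y - f x) ^ 2 / ‖y - x‖ ^ (finrank ℝ E + 1)) := by fun_prop
    calc ω * N = ∫⁻ x in S, ω * ENNReal.ofReal (f x ^ 2 / ‖x‖) :=
          (lintegral_const_mul' _ _ hω).symm
      _ ≤ ∫⁻ x in S, (2 * (∫⁻ y in ball ((8 : ℝ) • x) ‖x‖,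
            ENNReal.ofReal (f y ^ 2 / ‖x‖ ^ (finrank ℝ E + 1))) + 2 * (8 ^ (finrank ℝ E + 1) *
            ∫⁻ y, ENNReal.ofReal ((f y - f x) ^ 2 / ‖y - x‖ ^ (finrank ℝ E + 1)))) :=
          setLIntegral_mono' hS fun x hx => volume_mul_sq_div_norm_le hf
            (norm_pos_iff.1 (hε.trans hx))
      _ ≤ _ := by
          rw [lintegral_add_right _ (hmeas.const_mul 2), lintegral_const_mul' _ _ (by simp),
            lintegral_const_mul' _ _ (by simp), lintegral_const_mul' _ _ (by simp)]
          gcongr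
          · exact lintegral_lintegral_ball_le hd hf ε
          · rw [gagliardo_eq_lintegral_sub hf]
            exact setLIntegral_le_lintegral _ _
  rw [hardyConst, ENNReal.mul_comm_div, ← mul_div_assoc, ENNReal.le_div_iff_mul_le
    (.inl hω₀) (.inl hω)]
  have hfin : ω * N ≠ ∞ := ENNReal.mul_ne_top hω (setLIntegral_sq_div_norm_ne_top hf₂ hε)
  calc N * ω = ω * N := mul_comm _ _
    _ ≤ 2 * (2 * (8 ^ (finrank ℝ E + 1) * gagliardo f)) :=
      le_two_mul_of_le_half_add hfin habsorb
    _ = _ := by ring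

theorem lintegral_sq_div_norm_le (hd : 2 ≤ finrank ℝ E) {f : E → ℝ} (hf : Measurable f)
    (hf₂ : ∫⁻ x, ENNReal.ofReal (f x ^ 2) ≠ ∞) :
    ∫⁻ x, ENNReal.ofReal (f x ^ 2 / ‖x‖) ≤ hardyConst E * gagliardo f := by
  have hunion : (⋃ n : ℕ, {x : E | 1 / ((n : ℝ) + 1) < ‖x‖}) = {0}ᶜ := by
    ext x
    simp only [Set.mem_iUnion, Set.mem_compl_iff, Set.mem_singleton_iff, ← norm_pos_iff]
    exact ⟨fun ⟨n, hn⟩ => lt_trans (by positivity) hn, exists_nat_one_div_lt⟩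
  have hmono : Monotone fun n : ℕ => {x : E | 1 / ((n : ℝ) + 1) < ‖x‖} := by
    intro n k hnk x (hx : 1 / ((n : ℝ) + 1) < ‖x‖)
    exact lt_of_le_of_lt (by gcongr) hx
  have : Nontrivial E := nontrivial_of_finrank_pos (R := ℝ) (by lia)
  rw [← restrict_compl_singleton (μ := (volume : Measure E)) (0 : E), ← hunion,
    setLIntegral_iUnion_of_directed _ hmono.directed_le]
  exact iSup_le fun n => setLIntegral_sq_div_norm_le hd hf hf₂ (by positivity)

theorem lintegral_sq_div_norm_sub_le (hd : 2 ≤ finrank ℝ E) {f : E → ℝ} (hf : Measurable f)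
    (hf₂ : ∫⁻ x, ENNReal.ofReal (f x ^ 2) ≠ ∞) (a : E) :
    ∫⁻ x, ENNReal.ofReal (f x ^ 2 / ‖a - x‖) ≤ hardyConst E * gagliardo f := by
  rw [← gagliardo_comp_add f a, ← lintegral_add_right_eq_self _ a]
  simp only [sub_add_cancel_right, norm_neg]
  refine lintegral_sq_div_norm_le hd (by fun_prop) ?_
  rwa [lintegral_add_right_eq_self (fun x => ENNReal.ofReal (f x ^ 2)) a]

end Hardy

section Sobolev

theorem norm_fourierL2 (u : L2) : ‖fourierL2 u‖ = ‖u‖ :=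
  ((Lp.fourierTransformₗᵢ R3 ℂ).norm_map _).trans (norm_ofRealCLM_compLp u)

theorem integrable_norm_sq_fourierL2 (u : L2) : Integrable fun ξ => ‖fourierL2 u ξ‖ ^ 2 :=
  integrable_norm_sq_coeFn (fourierL2 u)

theorem integral_norm_sq_fourierL2 (u : L2) : ∫ ξ, ‖fourierL2 u ξ‖ ^ 2 = ‖u‖ ^ 2 :=
  (integral_norm_sq_coeFn (fourierL2 u)).trans (by rw [norm_fourierL2])

theorem aestronglyMeasurable_mul_norm_sq_fourierL2 (u : L2) {w : R3 → ℝ} (hw : Continuous w) :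
    AEStronglyMeasurable (fun ξ => w ξ * ‖fourierL2 u ξ‖ ^ 2) :=
  hw.aestronglyMeasurable.mul (integrable_norm_sq_fourierL2 u).aestronglyMeasurable

theorem memHHalf_iff_integrable (u : L2) :
    MemHHalf u ↔ Integrable fun ξ => 2 * Real.pi * ‖ξ‖ * ‖fourierL2 u ξ‖ ^ 2 := by
  simp_rw [MemHHalf, add_mul, one_mul]
  exact integrable_add_iff_integrable_right (integrable_norm_sq_fourierL2 u)

theorem gagliardo_eq_lintegral_fourierL2 (u : L2) :
    gagliardo u = ENNReal.ofReal (gagliardoConst R3) *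
      ∫⁻ ξ, ENNReal.ofReal (2 * Real.pi * ‖ξ‖ * ‖fourierL2 u ξ‖ ^ 2) :=
  gagliardo_eq_lintegral_fourier u

theorem memHHalf_iff_gagliardo_ne_top (u : L2) : MemHHalf u ↔ gagliardo u ≠ ∞ := by
  rw [memHHalf_iff_integrable, ← lintegral_ofReal_ne_top_iff_integrable
    (aestronglyMeasurable_mul_norm_sq_fourierL2 u (by fun_prop))
    (Eventually.of_forall fun ξ => by positivity), gagliardo_eq_lintegral_fourierL2,
    ne_eq, ne_eq, ENNReal.mul_eq_top]
  simp only [ne_eq, ENNReal.ofReal_eq_zero, not_le, gagliardoConst_pos, true_and,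
    ENNReal.ofReal_ne_top, false_and, or_false]

theorem quarterLaplacianSq_eq (u : L2) :
    quarterLaplacianSq u = (gagliardo u).toReal / gagliardoConst R3 := by
  have hc : 0 < gagliardoConst R3 := gagliardoConst_pos
  rw [gagliardo_eq_lintegral_fourierL2, ENNReal.toReal_mul, ENNReal.toReal_ofReal hc.le,
    mul_div_cancel_left₀ _ hc.ne', quarterLaplacianSq,
    integral_eq_lintegral_of_nonneg_ae (Eventually.of_forall fun _ => by positivity)
    (aestronglyMeasurable_mul_norm_sq_fourierL2 u (by fun_prop))]

end Sobolev

section CoulombPotential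

variable {E : Type*} [NormedAddCommGroup E] [MeasureSpace E]

/-- The potential `φ_f(x) = ∫ f(y)² / |x - y| dy` with values in `[0, ∞]`. -/
def ePhi (f : E → ℝ) (x : E) : ℝ≥0∞ := ∫⁻ y, ENNReal.ofReal (f y ^ 2 / ‖x - y‖)

/-- The Coulomb energy `∬ f(y)² g(x)² / |x - y| dy dx` with values in `[0, ∞]`. -/
def eCoulomb (f g : E → ℝ) : ℝ≥0∞ :=
  ∫⁻ x, ∫⁻ y, ENNReal.ofReal (f y ^ 2 / ‖x - y‖ * g x ^ 2)

theorem eCoulomb_eq_lintegral_ePhi (f g : E → ℝ) :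
    eCoulomb f g = ∫⁻ x, ePhi f x * ENNReal.ofReal (g x ^ 2) := by
  refine lintegral_congr fun x => ?_
  simp_rw [ENNReal.ofReal_mul (div_nonneg (sq_nonneg _) (norm_nonneg _))]
  rw [lintegral_mul_const' _ _ ENNReal.ofReal_ne_top, ePhi]

variable [BorelSpace E]

theorem ae_eq_zero_of_ePhi_eq_zero [NullSingletonClass (volume : Measure E)] {f : E → ℝ}
    (hf : Measurable f) {x : E} (h : ePhi f x = 0) : f =ᵐ[volume] 0 := by
  rw [ePhi, lintegral_eq_zero_iff (by fun_prop)] at h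
  filter_upwards [h, Measure.ae_ne volume x] with y hy hyx
  have hpos : 0 < ‖x - y‖ := norm_sub_pos_iff.2 hyx.symm
  rw [Pi.zero_apply, ENNReal.ofReal_eq_zero, div_le_iff₀ hpos, zero_mul] at hy
  exact pow_eq_zero_iff two_ne_zero |>.1 (hy.antisymm (sq_nonneg _))

variable [SecondCountableTopology E] [SFinite (volume : Measure E)]

theorem measurable_ePhi {f : E → ℝ} (hf : Measurable f) : Measurable (ePhi f) := by
  unfold ePhi
  fun_prop

theorem eCoulomb_comm {f g : E → ℝ} (hf : Measurable f) (hg : Measurable g) :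
    eCoulomb f g = eCoulomb g f := by
  rw [eCoulomb, lintegral_lintegral_swap]
  · refine lintegral_congr fun x => lintegral_congr fun y => ?_
    rw [norm_sub_rev, div_mul_eq_mul_div, div_mul_eq_mul_div, mul_comm]
  · refine Measurable.aemeasurable ?_
    simp only [Function.uncurry_def]
    fun_prop

theorem ae_eq_zero_of_eCoulomb_eq_zero [NullSingletonClass (volume : Measure E)]
    {f g : E → ℝ} (hf : Measurable f) (hg : Measurable g) (h : eCoulomb f g = 0) :
    f =ᵐ[volume] 0 ∨ g =ᵐ[volume] 0 := by
  by_cases hx : ∃ x, ePhi f x = 0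
  · exact .inl (ae_eq_zero_of_ePhi_eq_zero hf hx.choose_spec)
  · push Not at hx
    have := measurable_ePhi hf
    rw [eCoulomb_eq_lintegral_ePhi, lintegral_eq_zero_iff (by fun_prop)] at h
    refine .inr (h.mono fun x hgx => ?_)
    rw [Pi.zero_apply, mul_eq_zero, or_iff_right (hx x), ENNReal.ofReal_eq_zero] at hgx
    exact pow_eq_zero_iff two_ne_zero |>.1 (hgx.antisymm (sq_nonneg _))

end CoulombPotential

section Coulomb

theorem hardyConst_ne_top : hardyConst R3 ≠ ∞ :=
  ENNReal.div_ne_top (by finiteness) (measure_ball_pos _ _ one_pos).ne'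

theorem ePhi_le (u : L2) (x : R3) : ePhi u x ≤ hardyConst R3 * gagliardo u :=
  lintegral_sq_div_norm_sub_le (by simp) (measurable_coeFn u)
    (by rw [lintegral_sq_coeFn]; exact ENNReal.ofReal_ne_top) x

theorem hardyConst_mul_gagliardo_ne_top {u : L2} (hu : MemHHalf u) :
    hardyConst R3 * gagliardo u ≠ ∞ :=
  ENNReal.mul_ne_top hardyConst_ne_top ((memHHalf_iff_gagliardo_ne_top u).1 hu)

theorem ePhi_ne_top {u : L2} (hu : MemHHalf u) (x : R3) : ePhi u x ≠ ∞ :=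
  ne_top_of_le_ne_top (hardyConst_mul_gagliardo_ne_top hu) (ePhi_le u x)

theorem eCoulomb_ne_top {u : L2} (hu : MemHHalf u) (v : L2) : eCoulomb u v ≠ ∞ := by
  refine ne_top_of_le_ne_top (ENNReal.mul_ne_top (hardyConst_mul_gagliardo_ne_top hu)
    (ENNReal.ofReal_ne_top (r := ‖v‖ ^ 2))) ?_
  rw [eCoulomb_eq_lintegral_ePhi, ← lintegral_sq_coeFn,
    ← lintegral_const_mul' _ _ (hardyConst_mul_gagliardo_ne_top hu)]
  gcongr with x
  exact ePhi_le u x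

theorem phi_eq_toReal (u : L2) (x : R3) : phi u x = (ePhi u x).toReal := by
  have := measurable_coeFn u
  rw [phi, integral_eq_lintegral_of_nonneg_ae (Eventually.of_forall fun _ => by positivity)
    (Measurable.aestronglyMeasurable (by fun_prop)), ePhi]

theorem phi_nonneg (u : L2) (x : R3) : 0 ≤ phi u x :=
  integral_nonneg fun _ => by positivity

theorem measurable_phi (u : L2) : Measurable (phi u) := by
  rw [funext (phi_eq_toReal u)]
  exact (measurable_ePhi (measurable_coeFn u)).ennreal_toReal

theorem phi_le {u : L2} (hu : MemHHalf u) (x : R3) :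
    phi u x ≤ (hardyConst R3 * gagliardo u).toReal := by
  rw [phi_eq_toReal]
  exact ENNReal.toReal_mono (hardyConst_mul_gagliardo_ne_top hu) (ePhi_le u x)

theorem coulomb_eq_toReal {u : L2} (hu : MemHHalf u) (v : L2) :
    coulomb u v = (eCoulomb u v).toReal := by
  rw [coulomb, integral_eq_lintegral_of_nonneg_ae
    (Eventually.of_forall fun x => mul_nonneg (phi_nonneg u x) (sq_nonneg _))
    ((measurable_phi u).mul ((measurable_coeFn v).pow_const 2)).aestronglyMeasurable,
    eCoulomb_eq_lintegral_ePhi]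
  congr 1
  refine lintegral_congr fun x => ?_
  rw [ENNReal.ofReal_mul (phi_nonneg u x), phi_eq_toReal, ENNReal.ofReal_toReal (ePhi_ne_top hu x)]

theorem coulomb_nonneg (u v : L2) : 0 ≤ coulomb u v :=
  integral_nonneg fun x => mul_nonneg (phi_nonneg u x) (sq_nonneg _)

theorem coulomb_pos {u v : L2} (hu : MemHHalf u) (hu₀ : u ≠ 0) (hv₀ : v ≠ 0) :
    0 < coulomb u v := by
  rw [coulomb_eq_toReal hu]
  refine ENNReal.toReal_pos (fun h => ?_) (eCoulomb_ne_top hu v)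
  rcases ae_eq_zero_of_eCoulomb_eq_zero (measurable_coeFn u) (measurable_coeFn v) h with h | h
  · exact hu₀ ((Lp.eq_zero_iff_ae_eq_zero).2 h)
  · exact hv₀ ((Lp.eq_zero_iff_ae_eq_zero).2 h)

theorem coulomb_comm {u v : L2} (hu : MemHHalf u) (hv : MemHHalf v) :
    coulomb u v = coulomb v u := by
  rw [coulomb_eq_toReal hu, coulomb_eq_toReal hv,
    eCoulomb_comm (measurable_coeFn u) (measurable_coeFn v)]

theorem integrable_phi_mul_sq {u : L2} (hu : MemHHalf u) (v : L2) :
    Integrable fun x => phi u x * v x ^ 2 := by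
  refine (integrable_sq_coeFn v).bdd_mul (c := (hardyConst R3 * gagliardo u).toReal)
    (measurable_phi u).aestronglyMeasurable (Eventually.of_forall fun x => ?_)
  rw [Real.norm_of_nonneg (phi_nonneg u x)]
  exact phi_le hu x

theorem abs_coulomb_sub_le {u : L2} (hu : MemHHalf u) (v w : L2) :
    |coulomb u v - coulomb u w| ≤
      (hardyConst R3 * gagliardo u).toReal * ∫ x, |v x ^ 2 - w x ^ 2| := by
  rw [coulomb, coulomb, ← integral_sub (integrable_phi_mul_sq hu v) (integrable_phi_mul_sq hu w),
    ← integral_const_mul]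
  refine abs_integral_le_integral_abs.trans (integral_mono
    ((integrable_phi_mul_sq hu v).sub (integrable_phi_mul_sq hu w)).abs
    (((integrable_sq_coeFn v).sub (integrable_sq_coeFn w)).abs.const_mul _) fun x => ?_)
  simp only [← mul_sub, abs_mul, abs_of_nonneg (phi_nonneg u x)]
  gcongr
  exact phi_le hu x

theorem tendsto_coulomb {ι : Type*} {l : Filter ι} {u v : ι → L2} {u₀ v₀ : L2}
    (hu : Tendsto u l (𝓝 u₀)) (hv : Tendsto v l (𝓝 v₀)) {M : ℝ≥0∞} (hM : M ≠ ∞)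
    (huM : ∀ᶠ i in l, gagliardo (u i) ≤ M) (hu₀ : MemHHalf u₀) (hv₀ : MemHHalf v₀) :
    Tendsto (fun i => coulomb (u i) (v i)) l (𝓝 (coulomb u₀ v₀)) := by
  rw [tendsto_iff_norm_sub_tendsto_zero]
  have hbound := ((tendsto_integral_abs_sq_sub_sq hv).const_mul (hardyConst R3 * M).toReal).add
    ((tendsto_integral_abs_sq_sub_sq hu).const_mul (hardyConst R3 * gagliardo v₀).toReal)
  rw [mul_zero, mul_zero, add_zero] at hbound
  refine squeeze_zero' (Eventually.of_forall fun _ => norm_nonneg _) ?_ hbound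
  filter_upwards [huM] with i hi
  have hmem : MemHHalf (u i) := (memHHalf_iff_gagliardo_ne_top _).2 (ne_top_of_le_ne_top hM hi)
  refine (abs_sub_le _ (coulomb (u i) v₀) _).trans (add_le_add ?_ ?_)
  · refine (abs_coulomb_sub_le hmem _ _).trans ?_
    have hconst := ENNReal.mul_ne_top hardyConst_ne_top hM
    gcongr
  · rw [coulomb_comm hmem hv₀, coulomb_comm hu₀ hv₀]
    exact abs_coulomb_sub_le hv₀ _ _

end Coulomb

section SetAverage

variable {α : Type*} [MeasurableSpace α] {μ : Measure α} {s : Set α}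

theorem ofReal_sq_setAverage_sub_le (d : Lp ℝ 2 μ) (hs₀ : μ s ≠ 0) (hs : μ s ≠ ∞) (c : ℝ) :
    ENNReal.ofReal (((⨍ y in s, d y ∂μ) - c) ^ 2) ≤
      (∫⁻ y in s, ENNReal.ofReal ((d y - c) ^ 2) ∂μ) / μ s := by
  have := isFiniteMeasure_restrict.2 hs
  have hmem : MemLp (fun y => d y - c) 2 (μ.restrict s) :=
    ((Lp.memLp d).restrict s).sub (memLp_const c)
  have hint : IntegrableOn d s μ := ((Lp.memLp d).restrict s).integrable one_le_two
  have haverage : ⨍ y in s, (d y - c) ∂μ = (⨍ y in s, d y ∂μ) - c := by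
    conv_rhs => rw [← setAverage_const hs₀ hs c]
    simp only [setAverage_eq, integral_sub hint (integrable_const c), smul_sub]
  rw [← ofReal_setAverage hmem.integrable_sq (Eventually.of_forall fun _ => sq_nonneg _),
    ← haverage]
  exact ENNReal.ofReal_le_ofReal ((even_two.convexOn_pow (𝕜 := ℝ)).map_set_average_le
    (by fun_prop) isClosed_univ hs₀ hs (by simp) (hmem.integrable one_le_two) hmem.integrable_sq)

theorem ofReal_add_sq_le (a b : ℝ) :
    ENNReal.ofReal ((a + b) ^ 2) ≤ 2 * ENNReal.ofReal (a ^ 2) + 2 * ENNReal.ofReal (b ^ 2) := by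
  rw [← mul_add, ← ENNReal.ofReal_add (sq_nonneg a) (sq_nonneg b), ← ENNReal.ofReal_ofNat,
    ← ENNReal.ofReal_mul zero_le_two]
  exact ENNReal.ofReal_le_ofReal add_sq_le

theorem setLIntegral_sq_sub_coeFn_le (u v : Lp ℝ 2 μ) (s : Set α) :
    ∫⁻ x in s, ENNReal.ofReal ((u - v) x ^ 2) ∂μ ≤
      2 * (∫⁻ x in s, ENNReal.ofReal (u x ^ 2) ∂μ) +
        2 * ∫⁻ x in s, ENNReal.ofReal (v x ^ 2) ∂μ := by
  have := measurable_coeFn u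
  rw [← lintegral_const_mul' _ _ ENNReal.ofNat_ne_top,
    ← lintegral_const_mul' _ _ ENNReal.ofNat_ne_top, ← lintegral_add_left (by fun_prop)]
  refine lintegral_mono_ae (ae_restrict_of_ae ?_)
  filter_upwards [Lp.coeFn_sub u v] with x hx
  rw [hx, Pi.sub_apply, sub_eq_add_neg, ← neg_sq (v x)]
  exact ofReal_add_sq_le (u x) (-v x)

end SetAverage

section Rellich

variable {E : Type*} [NormedAddCommGroup E] [InnerProductSpace ℝ E] [FiniteDimensional ℝ E]
  [MeasurableSpace E] [BorelSpace E]

theorem ofReal_sq_le_ball_average (d : Lp ℝ 2 (volume : Measure E)) (x : E) {r : ℝ} (hr : 0 < r) :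
    ENNReal.ofReal (d x ^ 2) ≤ 2 * ENNReal.ofReal ((⨍ y in ball x r, d y) ^ 2) +
      2 * (ENNReal.ofReal r / volume (ball (0 : E) 1) *
        ∫⁻ y, ENNReal.ofReal ((d y - d x) ^ 2 / ‖y - x‖ ^ (finrank ℝ E + 1))) := by
  have hmean := (ofReal_sq_setAverage_sub_le d (measure_ball_pos volume x hr).ne'
    measure_ball_lt_top.ne (d x)).trans
      (ENNReal.div_le_div_right (setLIntegral_sq_sub_le d ball_subset_closedBall) _)
  rw [Measure.addHaar_ball_of_pos volume x hr, pow_succ r, ENNReal.ofReal_mul (pow_nonneg hr.le _),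
    mul_assoc, ENNReal.mul_div_mul_left _ _ (by simpa using pow_pos hr _) ENNReal.ofReal_ne_top,
    ENNReal.mul_div_right_comm] at hmean
  refine le_trans ?_ ((ofReal_add_sq_le (⨍ y in ball x r, d y)
    (-((⨍ y in ball x r, d y) - d x))).trans ?_)
  · rw [neg_sub, add_sub_cancel]
  · rw [neg_sq]
    gcongr

theorem measurable_ball_average (d : Lp ℝ 2 (volume : Measure E)) (r : ℝ) :
    Measurable fun x => ⨍ y in ball x r, d y := by
  have hd := measurable_coeFn d
  have hball : MeasurableSet {p : E × E | dist p.2 p.1 < r} :=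
    measurableSet_lt (by fun_prop) (by fun_prop)
  have hint : Measurable fun x => ∫ y in ball x r, d y := by
    simp_rw [← integral_indicator measurableSet_ball]
    exact ((by fun_prop : Measurable fun p : E × E => d p.2).indicator
      hball).stronglyMeasurable.integral_prod_right'.measurable
  simp_rw [setAverage_eq, measureReal_def, Measure.addHaar_ball_center]
  exact hint.const_smul (volume (ball (0 : E) r)).toReal⁻¹

theorem setLIntegral_sq_le_ball_average (d : Lp ℝ 2 (volume : Measure E)) (s : Set E) {r : ℝ}
    (hr : 0 < r) :
    ∫⁻ x in s, ENNReal.ofReal (d x ^ 2) ≤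
      2 * (∫⁻ x in s, ENNReal.ofReal ((⨍ y in ball x r, d y) ^ 2)) +
        2 * (ENNReal.ofReal r / volume (ball (0 : E) 1) * gagliardo d) := by
  have hmeas := measurable_ball_average d r
  have hconst : ENNReal.ofReal r / volume (ball (0 : E) 1) ≠ ∞ :=
    ENNReal.div_ne_top ENNReal.ofReal_ne_top (measure_ball_pos _ _ one_pos).ne'
  refine (lintegral_mono fun x => ofReal_sq_le_ball_average d x hr).trans ?_
  rw [lintegral_add_left (by fun_prop), lintegral_const_mul' _ _ ENNReal.ofNat_ne_top,
    lintegral_const_mul' _ _ ENNReal.ofNat_ne_top, lintegral_const_mul' _ _ hconst,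
    gagliardo_eq_lintegral_sub (measurable_coeFn d)]
  gcongr
  exact Measure.restrict_le_self

theorem ball_average_eq_inner (d : Lp ℝ 2 (volume : Measure E)) (x : E) (r : ℝ) :
    ⨍ y in ball x r, d y = (volume.real (ball (0 : E) r))⁻¹ *
      inner ℝ (indicatorConstLp 2 measurableSet_ball (measure_ball_lt_top (x := x) (r := r)).ne
        (1 : ℝ)) d := by
  rw [setAverage_eq, L2.inner_indicatorConstLp_one, smul_eq_mul, measureReal_def, measureReal_def,
    Measure.addHaar_ball_center]

theorem abs_ball_average_le (d : Lp ℝ 2 (volume : Measure E)) (x : E) (r : ℝ) :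
    |⨍ y in ball x r, d y| ≤
      (volume.real (ball (0 : E) r))⁻¹ * (volume.real (ball (0 : E) r) ^ (1 / 2 : ℝ) * ‖d‖) := by
  rw [ball_average_eq_inner, abs_mul, abs_of_nonneg (by positivity)]
  gcongr
  refine (abs_real_inner_le_norm _ _).trans_eq ?_
  rw [norm_indicatorConstLp (by simp) (by simp), norm_one, one_mul, ENNReal.toReal_ofNat,
    measureReal_def, measureReal_def, Measure.addHaar_ball_center]

variable {ι : Type*} {l : Filter ι} [l.IsCountablyGenerated]
  {d : ι → Lp ℝ 2 (volume : Measure E)} {C : ℝ} {M : ℝ≥0∞} {s : Set E}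

theorem tendsto_setLIntegral_sq_ball_average (hs : volume s ≠ ∞) (hd : ∀ i, ‖d i‖ ≤ C)
    (hweak : ∀ v, Tendsto (fun i => inner ℝ v (d i)) l (𝓝 0)) (r : ℝ) :
    Tendsto (fun i => ∫⁻ x in s, ENNReal.ofReal ((⨍ y in ball x r, d i y) ^ 2)) l (𝓝 0) := by
  have hlim := tendsto_lintegral_filter_of_dominated_convergence (μ := volume.restrict s) (l := l)
    (F := fun i x => ENNReal.ofReal ((⨍ y in ball x r, d i y) ^ 2)) (f := fun _ => 0)
    (fun _ => ENNReal.ofReal (((volume.real (ball (0 : E) r))⁻¹ *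
      (volume.real (ball (0 : E) r) ^ (1 / 2 : ℝ) * C)) ^ 2)) ?_ ?_ ?_ ?_
  · simpa only [lintegral_zero] using hlim
  · refine Eventually.of_forall fun i => ?_
    have := measurable_ball_average (d i) r
    fun_prop
  · refine Eventually.of_forall fun i => Eventually.of_forall fun x => ENNReal.ofReal_le_ofReal ?_
    rw [← sq_abs]
    gcongr
    refine (abs_ball_average_le (d i) x r).trans ?_
    gcongr
    exact hd i
  · rw [setLIntegral_const]
    exact ENNReal.mul_ne_top ENNReal.ofReal_ne_top hs
  · refine Eventually.of_forall fun x => ?_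
    simp_rw [ball_average_eq_inner]
    simpa using ENNReal.tendsto_ofReal (((hweak _).const_mul _).pow 2)

theorem tendsto_setLIntegral_sq (hs : volume s ≠ ∞) (hd : ∀ i, ‖d i‖ ≤ C) (hM : M ≠ ∞)
    (hdM : ∀ i, gagliardo (d i) ≤ M) (hweak : ∀ v, Tendsto (fun i => inner ℝ v (d i)) l (𝓝 0)) :
    Tendsto (fun i => ∫⁻ x in s, ENNReal.ofReal (d i x ^ 2)) l (𝓝 0) := by
  rw [ENNReal.tendsto_nhds_zero]
  intro ε hε
  have hsmall : Tendsto (fun r => 2 * (ENNReal.ofReal r / volume (ball (0 : E) 1) * M))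
      (𝓝[>] 0) (𝓝 0) := by
    have hid : Tendsto ENNReal.ofReal (𝓝[>] 0) (𝓝 0) := by
      simpa using (ENNReal.continuous_ofReal.tendsto 0).mono_left nhdsWithin_le_nhds
    simpa using ENNReal.Tendsto.const_mul (ENNReal.Tendsto.mul_const
      (ENNReal.Tendsto.div_const hid (.inr (measure_ball_pos volume (0 : E) one_pos).ne'))
      (.inr hM)) (.inr ENNReal.ofNat_ne_top)
  obtain ⟨r, hrε, hr : 0 < r⟩ := ((ENNReal.tendsto_nhds_zero.1 hsmall (ε / 2)
    (ENNReal.half_pos hε.ne')).and self_mem_nhdsWithin).exists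
  have haverage := ENNReal.Tendsto.const_mul (a := 2)
    (tendsto_setLIntegral_sq_ball_average hs hd hweak r) (.inr ENNReal.ofNat_ne_top)
  rw [mul_zero] at haverage
  filter_upwards [ENNReal.tendsto_nhds_zero.1 haverage (ε / 2) (ENNReal.half_pos hε.ne')] with i hi
  calc ∫⁻ x in s, ENNReal.ofReal (d i x ^ 2)
      ≤ 2 * (∫⁻ x in s, ENNReal.ofReal ((⨍ y in ball x r, d i y) ^ 2)) +
          2 * (ENNReal.ofReal r / volume (ball (0 : E) 1) * gagliardo (d i)) :=
        setLIntegral_sq_le_ball_average (d i) s hr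
    _ ≤ ε / 2 + ε / 2 := by
        gcongr
        exact le_trans (by gcongr; exact hdM i) hrε
    _ = ε := ENNReal.add_halves ε

theorem tendsto_zero_of_tight (hd : ∀ i, ‖d i‖ ≤ C) (hM : M ≠ ∞) (hdM : ∀ i, gagliardo (d i) ≤ M)
    (htight : ∀ ε ≠ 0, ∃ R : ℝ, ∀ i,
      ∫⁻ x in (closedBall 0 R)ᶜ, ENNReal.ofReal (d i x ^ 2) ≤ ε)
    (hweak : ∀ v, Tendsto (fun i => inner ℝ v (d i)) l (𝓝 0)) : Tendsto d l (𝓝 0) := by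
  have hsq : Tendsto (fun i => ENNReal.ofReal (‖d i‖ ^ 2)) l (𝓝 0) := by
    rw [ENNReal.tendsto_nhds_zero]
    intro ε hε
    obtain ⟨R, hR⟩ := htight (ε / 2) (ENNReal.half_pos hε.ne').ne'
    have hlocal := tendsto_setLIntegral_sq (s := closedBall 0 R) measure_closedBall_lt_top.ne
      hd hM hdM hweak
    filter_upwards [ENNReal.tendsto_nhds_zero.1 hlocal (ε / 2) (ENNReal.half_pos hε.ne')] with i hi
    rw [← lintegral_sq_coeFn,
      ← lintegral_add_compl _ (measurableSet_closedBall (x := 0) (ε := R)), ← ENNReal.add_halves ε]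
    exact add_le_add hi (hR i)
  rw [tendsto_zero_iff_norm_tendsto_zero]
  simpa [Real.sqrt_sq] using ((ENNReal.tendsto_toReal ENNReal.zero_ne_top).comp hsq).sqrt

theorem exists_subseq_tendsto_inner {H : Type*} [NormedAddCommGroup H] [InnerProductSpace ℝ H]
    [CompleteSpace H] [TopologicalSpace.SeparableSpace H] {C : ℝ} {u : ℕ → H}
    (hu : ∀ n, ‖u n‖ ≤ C) :
    ∃ (u₀ : H) (σ : ℕ → ℕ), StrictMono σ ∧
      ∀ v, Tendsto (fun n => inner ℝ v (u (σ n))) atTop (𝓝 (inner ℝ v u₀)) := by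
  obtain ⟨ℓ, -, σ, hσ, hℓ⟩ := WeakDual.isSeqCompact_closedBall ℝ H 0 C
    (x := fun n => StrongDual.toWeakDual (InnerProductSpace.toDual ℝ H (u n))) fun n =>
      mem_closedBall_zero_iff.2 (((InnerProductSpace.toDual ℝ H).norm_map (u n)).le.trans (hu n))
  refine ⟨(InnerProductSpace.toDual ℝ H).symm (WeakDual.toStrongDual ℓ), σ, hσ, fun v => ?_⟩
  rw [real_inner_comm, InnerProductSpace.toDual_symm_apply]
  exact (((WeakDual.eval_continuous v).tendsto ℓ).comp hℓ).congr fun n => real_inner_comm _ _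

theorem exists_subseq_tendsto_of_tight {u : ℕ → Lp ℝ 2 (volume : Measure E)} {C : ℝ} {M : ℝ≥0∞}
    (hu : ∀ n, ‖u n‖ ≤ C) (hM : M ≠ ∞) (huM : ∀ n, gagliardo (u n) ≤ M)
    (htight : ∀ ε ≠ 0, ∃ R : ℝ, ∀ n,
      ∫⁻ x in (closedBall 0 R)ᶜ, ENNReal.ofReal (u n x ^ 2) ≤ ε) :
    ∃ (u₀ : Lp ℝ 2 (volume : Measure E)) (σ : ℕ → ℕ), StrictMono σ ∧
      Tendsto (fun n => u (σ n)) atTop (𝓝 u₀) := by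
  have : Fact ((2 : ℝ≥0∞) ≠ ∞) := ⟨ENNReal.ofNat_ne_top⟩
  obtain ⟨w, σ, hσ, hw⟩ := exists_subseq_tendsto_inner hu
  suffices hcauchy : CauchySeq fun n => u (σ n) by
    obtain ⟨u₀, hu₀⟩ := cauchySeq_tendsto_of_complete hcauchy
    exact ⟨u₀, σ, hσ, hu₀⟩
  rw [cauchySeq_iff_tendsto, _root_.uniformity_eq_comap_nhds_zero, tendsto_comap_iff]
  refine tendsto_zero_of_tight (d := fun p : ℕ × ℕ => u (σ p.2) - u (σ p.1)) (C := C + C)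
    (M := 2 * M + 2 * M) (fun p => norm_sub_le_of_le (hu _) (hu _)) (by finiteness)
    (fun p => (gagliardo_coeFn_sub_le _ _).trans (by gcongr <;> exact huM _)) (fun ε hε => ?_)
    (fun v => ?_)
  · have hε4 : ε / 4 ≠ 0 := by simpa using hε
    obtain ⟨R, hR⟩ := htight (ε / 4) hε4
    refine ⟨R, fun p => (setLIntegral_sq_sub_coeFn_le _ _ _).trans
      (le_trans (by gcongr <;> exact hR _) (?_ : 2 * (ε / 4) + 2 * (ε / 4) ≤ ε))⟩
    rw [← add_mul, two_add_two_eq_four]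
    exact ENNReal.mul_div_le
  · simp_rw [inner_sub_right]
    rw [← prod_atTop_atTop_eq, ← sub_self (inner ℝ v w)]
    exact ((hw v).comp tendsto_snd).sub ((hw v).comp tendsto_fst)

end Rellich

section LowerSemicontinuity

variable {α F : Type*} [MeasurableSpace α] {μ : Measure α} [NormedAddCommGroup F]

theorem integrable_and_integral_mul_norm_sq_le_of_tendsto {w : α → ℝ} (hw : ∀ x, 0 ≤ w x)
    {f : ℕ → Lp F 2 μ} {f₀ : Lp F 2 μ} (hf : Tendsto f atTop (𝓝 f₀))
    (hint : ∀ n, Integrable (fun x => w x * ‖f n x‖ ^ 2) μ) {c : ℝ}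
    (hc : Tendsto (fun n => ∫ x, w x * ‖f n x‖ ^ 2 ∂μ) atTop (𝓝 c)) :
    Integrable (fun x => w x * ‖f₀ x‖ ^ 2) μ ∧ ∫ x, w x * ‖f₀ x‖ ^ 2 ∂μ ≤ c := by
  obtain ⟨σ, hσ, hae⟩ := exists_subseq_tendsto_ae hf
  have hlim : ∀ᵐ x ∂μ, Tendsto (fun n => w x * ‖f (σ n) x‖ ^ 2) atTop (𝓝 (w x * ‖f₀ x‖ ^ 2)) :=
    hae.mono fun x hx => (hx.norm.pow 2).const_mul _
  have hnonneg (g : Lp F 2 μ) : 0 ≤ᵐ[μ] fun x => w x * ‖g x‖ ^ 2 :=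
    Eventually.of_forall fun x => mul_nonneg (hw x) (sq_nonneg _)
  have hc₀ : 0 ≤ c := ge_of_tendsto' hc fun n => integral_nonneg_of_ae (hnonneg (f n))
  have hmeas : AEStronglyMeasurable (fun x => w x * ‖f₀ x‖ ^ 2) μ :=
    aestronglyMeasurable_of_tendsto_ae atTop (fun n => (hint (σ n)).aestronglyMeasurable) hlim
  have hfatou : ∫⁻ x, ENNReal.ofReal (w x * ‖f₀ x‖ ^ 2) ∂μ ≤ ENNReal.ofReal c := by
    calc ∫⁻ x, ENNReal.ofReal (w x * ‖f₀ x‖ ^ 2) ∂μ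
        = ∫⁻ x, liminf (fun n => ENNReal.ofReal (w x * ‖f (σ n) x‖ ^ 2)) atTop ∂μ :=
          lintegral_congr_ae (hlim.mono fun x hx => (ENNReal.tendsto_ofReal hx).liminf_eq.symm)
      _ ≤ liminf (fun n => ∫⁻ x, ENNReal.ofReal (w x * ‖f (σ n) x‖ ^ 2) ∂μ) atTop :=
          lintegral_liminf_le' fun n =>
            (hint (σ n)).aestronglyMeasurable.aemeasurable.ennreal_ofReal
      _ = liminf (fun n => ENNReal.ofReal (∫ x, w x * ‖f (σ n) x‖ ^ 2 ∂μ)) atTop := by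
          simp_rw [ofReal_integral_eq_lintegral_ofReal (hint _) (hnonneg _)]
      _ = ENNReal.ofReal c := (ENNReal.tendsto_ofReal (hc.comp hσ.tendsto_atTop)).liminf_eq
  refine ⟨(lintegral_ofReal_ne_top_iff_integrable hmeas (hnonneg f₀)).1
    (ne_top_of_le_ne_top ENNReal.ofReal_ne_top hfatou), ?_⟩
  rw [integral_eq_lintegral_of_nonneg_ae (hnonneg f₀) hmeas]
  exact ENNReal.toReal_le_of_le_ofReal hc₀ hfatou

end LowerSemicontinuity

section Kinetic

theorem kinetic_symbol_le (m t : ℝ) (ht : 0 ≤ t) : √(t ^ 2 + m ^ 2) ≤ t + |m| :=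
  Real.sqrt_le_iff.2 ⟨by positivity, by nlinarith [abs_nonneg m, sq_abs m]⟩

theorem le_kinetic_symbol (m t : ℝ) : t ≤ √(t ^ 2 + m ^ 2) :=
  Real.le_sqrt_of_sq_le (le_add_of_nonneg_right (sq_nonneg m))

theorem integrable_kinetic_iff (m : ℝ) (u : L2) :
    (Integrable fun ξ => √((2 * Real.pi * ‖ξ‖) ^ 2 + m ^ 2) * ‖fourierL2 u ξ‖ ^ 2) ↔
      MemHHalf u := by
  rw [memHHalf_iff_integrable]
  refine ⟨fun h => ?_, fun h => ?_⟩
  · refine h.mono' (aestronglyMeasurable_mul_norm_sq_fourierL2 u (by fun_prop))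
      (Eventually.of_forall fun ξ => ?_)
    rw [Real.norm_of_nonneg (by positivity)]
    gcongr
    exact le_kinetic_symbol m _
  · refine (h.add ((integrable_norm_sq_fourierL2 u).const_mul |m|)).mono'
      (aestronglyMeasurable_mul_norm_sq_fourierL2 u (by fun_prop))
      (Eventually.of_forall fun ξ => ?_)
    rw [Real.norm_of_nonneg (by positivity), Pi.add_apply, ← add_mul]
    gcongr
    exact kinetic_symbol_le m _ (by positivity)

theorem quarterLaplacianSq_nonneg (u : L2) : 0 ≤ quarterLaplacianSq u :=
  integral_nonneg fun _ => by positivity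

theorem kinetic_nonneg (m : ℝ) (u : L2) : 0 ≤ kinetic m u :=
  integral_nonneg fun _ => by positivity

theorem quarterLaplacianSq_le_kinetic (m : ℝ) {u : L2} (hu : MemHHalf u) :
    quarterLaplacianSq u ≤ kinetic m u :=
  integral_mono ((memHHalf_iff_integrable u).1 hu) ((integrable_kinetic_iff m u).2 hu) fun _ =>
    mul_le_mul_of_nonneg_right (le_kinetic_symbol m _) (sq_nonneg _)

theorem kinetic_le (m : ℝ) {u : L2} (hu : MemHHalf u) :
    kinetic m u ≤ quarterLaplacianSq u + |m| * ‖u‖ ^ 2 := by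
  have hquarter := (memHHalf_iff_integrable u).1 hu
  have hmass := (integrable_norm_sq_fourierL2 u).const_mul |m|
  rw [← integral_norm_sq_fourierL2, ← integral_const_mul, quarterLaplacianSq,
    ← integral_add hquarter hmass]
  refine integral_mono ((integrable_kinetic_iff m u).2 hu) (hquarter.add hmass) fun ξ => ?_
  simp only [← add_mul]
  gcongr
  exact kinetic_symbol_le m _ (by positivity)

theorem gagliardo_eq_ofReal {u : L2} (hu : MemHHalf u) :
    gagliardo u = ENNReal.ofReal (gagliardoConst R3 * quarterLaplacianSq u) := by
  rw [quarterLaplacianSq_eq, mul_div_cancel₀ _ gagliardoConst_pos.ne',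
    ENNReal.ofReal_toReal ((memHHalf_iff_gagliardo_ne_top u).1 hu)]

theorem continuous_fourierL2 : Continuous fourierL2 :=
  (Lp.fourierTransformₗᵢ R3 ℂ).continuous.comp
    (ContinuousLinearMap.compLpL 2 volume Complex.ofRealCLM).continuous

theorem memHHalf_and_kinetic_le_of_tendsto {m : ℝ} {u : ℕ → L2} {u₀ : L2}
    (hu : Tendsto u atTop (𝓝 u₀)) (hmem : ∀ n, MemHHalf (u n)) {k : ℝ}
    (hk : Tendsto (fun n => kinetic m (u n)) atTop (𝓝 k)) : MemHHalf u₀ ∧ kinetic m u₀ ≤ k := by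
  obtain ⟨hint, hle⟩ := integrable_and_integral_mul_norm_sq_le_of_tendsto
    (fun _ => Real.sqrt_nonneg _) ((continuous_fourierL2.tendsto u₀).comp hu)
    (fun n => (integrable_kinetic_iff m _).2 (hmem n)) hk
  exact ⟨(integrable_kinetic_iff m u₀).1 hint, hle⟩

end Kinetic

section Trapping

variable {V : R3 → ℝ} {m : ℝ}

/-- The quadratic form `(√(-Δ + m²) u, u) + ∫ V u²` of a single particle in the trap `V`. -/
def trapEnergy (m : ℝ) (V : R3 → ℝ) (u : L2) : ℝ := kinetic m u + potentialTerm V u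

theorem IsTrapping.nonneg (hV : IsTrapping V) (x : R3) : 0 ≤ V x :=
  hV.inf_eq_zero.1 ⟨x, rfl⟩

theorem IsTrapping.potentialTerm_nonneg (hV : IsTrapping V) (u : L2) : 0 ≤ potentialTerm V u :=
  integral_nonneg fun x => mul_nonneg (hV.nonneg x) (sq_nonneg _)

theorem IsTrapping.kinetic_le_trapEnergy (hV : IsTrapping V) (u : L2) :
    kinetic m u ≤ trapEnergy m V u :=
  le_add_of_nonneg_right (hV.potentialTerm_nonneg u)

theorem IsTrapping.trapEnergy_nonneg (hV : IsTrapping V) (u : L2) : 0 ≤ trapEnergy m V u :=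
  (kinetic_nonneg m u).trans (hV.kinetic_le_trapEnergy u)

theorem IsTrapping.exists_radius (hV : IsTrapping V) (M : ℝ) :
    ∃ R : ℝ, ∀ x ∈ (closedBall (0 : R3) R)ᶜ, M ≤ V x := by
  obtain ⟨K, hK, hKV⟩ := mem_cocompact.1 (hV.tendsto_atTop.eventually_ge_atTop M)
  obtain ⟨R, hR⟩ := hK.isBounded.subset_closedBall 0
  exact ⟨R, fun x hx => hKV fun hxK => hx (hR hxK)⟩

theorem IsTrapping.setLIntegral_sq_le (hV : IsTrapping V) {M : ℝ} (hM : 0 < M) {s : Set R3}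
    (hs : MeasurableSet s) (hVs : ∀ x ∈ s, M ≤ V x) {u : L2}
    (hu : Integrable fun x => V x * u x ^ 2) :
    ∫⁻ x in s, ENNReal.ofReal (u x ^ 2) ≤ ENNReal.ofReal (potentialTerm V u / M) := by
  rw [potentialTerm, ← integral_div, ofReal_integral_eq_lintegral_ofReal (hu.div_const M)
    (Eventually.of_forall fun x => div_nonneg (mul_nonneg (hV.nonneg x) (sq_nonneg _)) hM.le)]
  refine (setLIntegral_mono' hs fun x hx => ENNReal.ofReal_le_ofReal ?_).trans
    (setLIntegral_le_lintegral _ _)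
  rw [le_div_iff₀' hM]
  exact mul_le_mul_of_nonneg_right (hVs x hx) (sq_nonneg _)

theorem IsTrapping.exists_setLIntegral_compl_closedBall_le (hV : IsTrapping V) (C : ℝ) {ε : ℝ≥0∞}
    (hε : ε ≠ 0) :
    ∃ R : ℝ, ∀ u ∈ trapSpace V, potentialTerm V u ≤ C →
      ∫⁻ x in (closedBall 0 R)ᶜ, ENNReal.ofReal (u x ^ 2) ≤ ε := by
  have hsmall : Tendsto (fun M : ℝ => ENNReal.ofReal (C / M)) atTop (𝓝 0) := by
    simpa using ENNReal.tendsto_ofReal (tendsto_const_nhds.div_atTop tendsto_id)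
  obtain ⟨M, hMε, hM⟩ := ((ENNReal.tendsto_nhds_zero.1 hsmall ε (pos_iff_ne_zero.2 hε)).and
    (eventually_gt_atTop 0)).exists
  obtain ⟨R, hR⟩ := hV.exists_radius M
  refine ⟨R, fun u hu huC => ?_⟩
  refine (hV.setLIntegral_sq_le hM measurableSet_closedBall.compl hR hu.2).trans (le_trans ?_ hMε)
  gcongr

theorem IsTrapping.gagliardo_le (hV : IsTrapping V) {u : L2} (hu : u ∈ trapSpace V) {C : ℝ}
    (hC : trapEnergy m V u ≤ C) : gagliardo u ≤ ENNReal.ofReal (gagliardoConst R3 * C) := by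
  have := gagliardoConst_pos (E := R3)
  rw [gagliardo_eq_ofReal hu.1]
  gcongr
  exact (quarterLaplacianSq_le_kinetic m hu.1).trans ((hV.kinetic_le_trapEnergy u).trans hC)

theorem IsTrapping.mem_trapSpace_and_trapEnergy_le_of_tendsto (hV : IsTrapping V) {u : ℕ → L2}
    {u₀ : L2} (hu : Tendsto u atTop (𝓝 u₀)) (hmem : ∀ n, u n ∈ trapSpace V) {k p : ℝ}
    (hk : Tendsto (fun n => kinetic m (u n)) atTop (𝓝 k))
    (hp : Tendsto (fun n => potentialTerm V (u n)) atTop (𝓝 p)) :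
    u₀ ∈ trapSpace V ∧ trapEnergy m V u₀ ≤ k + p := by
  obtain ⟨hH, hkinetic⟩ := memHHalf_and_kinetic_le_of_tendsto hu (fun n => (hmem n).1) hk
  have hpotential := integrable_and_integral_mul_norm_sq_le_of_tendsto (c := p) hV.nonneg hu
  simp only [Real.norm_eq_abs, sq_abs] at hpotential
  obtain ⟨hint, hle⟩ := hpotential (fun n => (hmem n).2) hp
  exact ⟨⟨hH, hint⟩, add_le_add hkinetic hle⟩

theorem IsTrapping.exists_subseq_tendsto (hV : IsTrapping V) {u : ℕ → L2} {C : ℝ}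
    (hu : ∀ n, u n ∈ trapSpace V) (hnorm : ∀ n, ‖u n‖ = 1) (hC : ∀ n, trapEnergy m V (u n) ≤ C) :
    ∃ (u₀ : L2) (σ : ℕ → ℕ) (t : ℝ), StrictMono σ ∧ Tendsto (fun n => u (σ n)) atTop (𝓝 u₀) ∧
      Tendsto (fun n => trapEnergy m V (u (σ n))) atTop (𝓝 t) ∧
      u₀ ∈ trapSpace V ∧ ‖u₀‖ = 1 ∧ trapEnergy m V u₀ ≤ t := by
  have hkinetic n : kinetic m (u n) ∈ Set.Icc 0 C :=
    ⟨kinetic_nonneg m _, (hV.kinetic_le_trapEnergy _).trans (hC n)⟩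
  have hpotential n : potentialTerm V (u n) ∈ Set.Icc 0 C :=
    ⟨hV.potentialTerm_nonneg _, (le_add_of_nonneg_left (kinetic_nonneg m _)).trans (hC n)⟩
  obtain ⟨u₀, σ, hσ, hlim⟩ := exists_subseq_tendsto_of_tight (fun n => (hnorm n).le)
    ENNReal.ofReal_ne_top (fun n => hV.gagliardo_le (hu n) (hC n)) fun ε hε => by
      obtain ⟨R, hR⟩ := hV.exists_setLIntegral_compl_closedBall_le C hε
      exact ⟨R, fun n => hR _ (hu n) (hpotential n).2⟩
  obtain ⟨k, -, τ, hτ, hk⟩ := isCompact_Icc.tendsto_subseq fun n => hkinetic (σ n)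
  obtain ⟨p, -, ρ, hρ, hp⟩ := isCompact_Icc.tendsto_subseq fun n => hpotential (σ (τ n))
  have hlim' : Tendsto (fun n => u (σ (τ (ρ n)))) atTop (𝓝 u₀) :=
    hlim.comp (hτ.comp hρ).tendsto_atTop
  have hk' := hk.comp hρ.tendsto_atTop
  obtain ⟨hmem, hle⟩ := hV.mem_trapSpace_and_trapEnergy_le_of_tendsto hlim' (fun n => hu _) hk' hp
  refine ⟨u₀, σ ∘ τ ∘ ρ, k + p, hσ.comp (hτ.comp hρ), hlim', hk'.add hp, hmem, ?_, hle⟩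
  simpa only [hnorm, tendsto_const_nhds_iff, eq_comm] using hlim'.norm

end Trapping

section Minimizer

variable {m a₁ a₂ β : ℝ} {V₁ V₂ : R3 → ℝ}

theorem integral_sq_eq_one_iff (u : L2) : ∫ x, u x ^ 2 = 1 ↔ ‖u‖ = 1 := by
  rw [integral_sq_coeFn]
  exact pow_eq_one_iff_of_nonneg (norm_nonneg u) two_ne_zero

theorem exists_coercivity (hV₁ : IsTrapping V₁) (hV₂ : IsTrapping V₂) (hη : 1 < eta a₁ a₂ β) :
    ∃ c > 0, ∀ w ∈ constraintSet V₁ V₂,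
      c * (trapEnergy m V₁ w.1 + trapEnergy m V₂ w.2) ≤ energy m V₁ V₂ a₁ a₂ β w := by
  obtain ⟨q, hq₁, hqη⟩ := EReal.lt_iff_exists_real_btwn.1 hη
  replace hq₁ : 1 < q := mod_cast hq₁
  have hq₀ : 0 < q := zero_lt_one.trans hq₁
  refine ⟨1 - 1 / q, sub_pos.2 ((div_lt_one hq₀).2 hq₁), fun w hw => ?_⟩
  obtain ⟨⟨hu, -⟩, ⟨hv, -⟩, hu₁, hv₁⟩ := hw
  have hJ : q < quotientJ a₁ a₂ β w :=
    mod_cast hqη.trans_le (iInf₂_le (f := fun w _ => (quotientJ a₁ a₂ β w : EReal)) w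
      ⟨hu, hv, hu₁, hv₁⟩)
  have hquarter : 2 * quarterLaplacianSq w.1 + 2 * quarterLaplacianSq w.2 ≤
      2 * (trapEnergy m V₁ w.1 + trapEnergy m V₂ w.2) := by
    rw [← mul_add]
    gcongr
    · exact (quarterLaplacianSq_le_kinetic m hu).trans (hV₁.kinetic_le_trapEnergy _)
    · exact (quarterLaplacianSq_le_kinetic m hv).trans (hV₂.kinetic_le_trapEnergy _)
  have hQ : 0 ≤ 2 * quarterLaplacianSq w.1 + 2 * quarterLaplacianSq w.2 := by
    linarith [quarterLaplacianSq_nonneg w.1, quarterLaplacianSq_nonneg w.2]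
  have hβ : β * coulomb w.1 w.2 ≤ max 0 β * coulomb w.1 w.2 :=
    mul_le_mul_of_nonneg_right (le_max_right 0 β) (coulomb_nonneg _ _)
  rw [quotientJ] at hJ
  set D := a₁ * coulomb w.1 w.1 + a₂ * coulomb w.2 w.2 + 2 * max 0 β * coulomb w.1 w.2
  have hD : 0 < D := by
    by_contra! hD
    exact (div_nonpos_of_nonneg_of_nonpos hQ hD).not_gt (hq₀.trans hJ)
  have hinteraction : D / 2 ≤ 1 / q * (trapEnergy m V₁ w.1 + trapEnergy m V₂ w.2) := by
    rw [one_div, ← div_eq_inv_mul, le_div_iff₀ hq₀]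
    linarith [(lt_div_iff₀ hD).1 hJ]
  have henergy : trapEnergy m V₁ w.1 + trapEnergy m V₂ w.2 - D / 2 ≤
      energy m V₁ V₂ a₁ a₂ β w := by
    simp only [energy, trapEnergy, D]
    linarith
  linarith

theorem exists_energy_le_of_tendsto (hV₁ : IsTrapping V₁) (hV₂ : IsTrapping V₂) {w : ℕ → L2 × L2}
    (hw : ∀ n, w n ∈ constraintSet V₁ V₂) {C : ℝ} (hC₁ : ∀ n, trapEnergy m V₁ (w n).1 ≤ C)
    (hC₂ : ∀ n, trapEnergy m V₂ (w n).2 ≤ C) {e : ℝ}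
    (he : Tendsto (fun n => energy m V₁ V₂ a₁ a₂ β (w n)) atTop (𝓝 e)) :
    ∃ w₀ ∈ constraintSet V₁ V₂, energy m V₁ V₂ a₁ a₂ β w₀ ≤ e := by
  have hnorm n := And.imp (integral_sq_eq_one_iff _).1 (integral_sq_eq_one_iff _).1 (hw n).2.2
  obtain ⟨u, σ, s, hσ, hu, hs, humem, hunorm, hus⟩ :=
    hV₁.exists_subseq_tendsto (fun n => (hw n).1) (fun n => (hnorm n).1) hC₁
  obtain ⟨v, τ, t, hτ, hv, ht, hvmem, hvnorm, hvt⟩ := hV₂.exists_subseq_tendsto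
    (fun n => (hw (σ n)).2.1) (fun n => (hnorm (σ n)).2) fun n => hC₂ (σ n)
  replace hu := hu.comp hτ.tendsto_atTop
  have hG₁ n := hV₁.gagliardo_le (hw n).1 (hC₁ n)
  have hG₂ n := hV₂.gagliardo_le (hw n).2.1 (hC₂ n)
  have huu := tendsto_coulomb hu hu ENNReal.ofReal_ne_top
    (Eventually.of_forall fun n => hG₁ _) humem.1 humem.1
  have hvv := tendsto_coulomb hv hv ENNReal.ofReal_ne_top
    (Eventually.of_forall fun n => hG₂ _) hvmem.1 hvmem.1
  have huv := tendsto_coulomb hu hv ENNReal.ofReal_ne_top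
    (Eventually.of_forall fun n => hG₁ _) humem.1 hvmem.1
  have henergy := (((hs.comp hτ.tendsto_atTop).add ht).sub
    ((huu.const_mul (a₁ / 2)).add (hvv.const_mul (a₂ / 2)))).sub (huv.const_mul β)
  refine ⟨(u, v), ⟨humem, hvmem, (integral_sq_eq_one_iff u).2 hunorm,
    (integral_sq_eq_one_iff v).2 hvnorm⟩, ?_⟩
  rw [tendsto_nhds_unique (he.comp (hσ.comp hτ).tendsto_atTop) henergy]
  exact sub_le_sub_right (sub_le_sub_right (add_le_add hus hvt) _) _

theorem exists_isMinimizer (hV₁ : IsTrapping V₁) (hV₂ : IsTrapping V₂) (hη : 1 < eta a₁ a₂ β)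
    (hne : (constraintSet V₁ V₂).Nonempty) : ∃ w, IsMinimizer m V₁ V₂ a₁ a₂ β w := by
  obtain ⟨c, hc, hcoercive⟩ := exists_coercivity (m := m) hV₁ hV₂ hη
  set S := energy m V₁ V₂ a₁ a₂ β '' constraintSet V₁ V₂
  have hS : BddBelow S := by
    refine ⟨0, ?_⟩
    rintro _ ⟨w, hw, rfl⟩
    exact (mul_nonneg hc.le (add_nonneg (hV₁.trapEnergy_nonneg _)
      (hV₂.trapEnergy_nonneg _))).trans (hcoercive w hw)
  obtain ⟨e, hanti, hlim, he⟩ := exists_seq_tendsto_sInf (hne.image _) hS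
  choose w hw hwe using he
  have hbound n : trapEnergy m V₁ (w n).1 + trapEnergy m V₂ (w n).2 ≤ e 0 / c := by
    rw [le_div_iff₀' hc]
    exact (hcoercive _ (hw n)).trans ((hwe n).le.trans (hanti (Nat.zero_le n)))
  obtain ⟨w₀, hw₀, hle⟩ := exists_energy_le_of_tendsto hV₁ hV₂ hw
    (fun n => (le_add_of_nonneg_right (hV₂.trapEnergy_nonneg _)).trans (hbound n))
    (fun n => (le_add_of_nonneg_left (hV₁.trapEnergy_nonneg _)).trans (hbound n))
    (hlim.congr fun n => (hwe n).symm)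
  refine ⟨w₀, hw₀, le_antisymm (le_iInf₂ fun w' hw' => ?_) (iInf₂_le _ hw₀)⟩
  exact EReal.coe_le_coe_iff.2 (hle.trans (csInf_le hS ⟨w', hw', rfl⟩))

end Minimizer

section Cutoff

variable {E : Type*} [NormedAddCommGroup E]

/-- A `1`-Lipschitz cutoff, equal to `1` on the ball of radius `n` and to `0` off the ball of radius
`n + 1` around the origin. -/
def cutoff (n : ℕ) (x : E) : ℝ :=
  thickenedIndicator one_pos (closedBall 0 n) x

theorem lipschitzWith_cutoff (n : ℕ) : LipschitzWith 1 (cutoff n : E → ℝ) := by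
  have h := (isometry_subtype_coe (s := {r : ℝ | 0 ≤ r})).lipschitz.comp
    (lipschitzWith_thickenedIndicator one_pos (closedBall (0 : E) n))
  rwa [Real.toNNReal_one, inv_one, one_mul] at h

theorem cutoff_nonneg (n : ℕ) (x : E) : 0 ≤ cutoff n x := NNReal.coe_nonneg _

theorem cutoff_le_one (n : ℕ) (x : E) : cutoff n x ≤ 1 :=
  thickenedIndicator_le_one one_pos _ x

theorem cutoff_eq_one {n : ℕ} {x : E} (hx : ‖x‖ ≤ n) : cutoff n x = 1 := by
  rw [cutoff, thickenedIndicator_one one_pos _ (mem_closedBall_zero_iff.2 hx), NNReal.coe_one]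

theorem tendsto_cutoff (x : E) : Tendsto (fun n => cutoff n x) atTop (𝓝 1) := by
  obtain ⟨N, hN⟩ := exists_nat_ge ‖x‖
  refine tendsto_const_nhds.congr' ?_
  filter_upwards [eventually_ge_atTop N] with n hn
  exact (cutoff_eq_one (hN.trans (mod_cast hn))).symm

theorem sq_cutoff_sub_le (n : ℕ) (x y : E) :
    (cutoff n x - cutoff n y) ^ 2 ≤ min 1 (‖x - y‖ ^ 2) := by
  have hlip : |cutoff n x - cutoff n y| ≤ ‖x - y‖ := by
    simpa [Real.dist_eq, dist_eq_norm] using (lipschitzWith_cutoff n).dist_le_mul x y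
  refine le_min (sq_le_one_iff_abs_le_one _ |>.2 (abs_le.2 ?_)) (sq_le_sq' ?_ (abs_le.1 hlip).2)
  · constructor <;> linarith [cutoff_nonneg n x, cutoff_le_one n x, cutoff_nonneg n y,
      cutoff_le_one n y]
  · exact (abs_le.1 hlip).1

theorem sq_cutoff_mul_sub_le (n : ℕ) (x y : E) (a b : ℝ) :
    (cutoff n x * a - cutoff n y * b) ^ 2 ≤
      2 * (a - b) ^ 2 + 2 * (min 1 (‖x - y‖ ^ 2) * b ^ 2) :=
  calc (cutoff n x * a - cutoff n y * b) ^ 2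
      = (cutoff n x * (a - b) + (cutoff n x - cutoff n y) * b) ^ 2 := by ring
    _ ≤ 2 * ((cutoff n x * (a - b)) ^ 2 + ((cutoff n x - cutoff n y) * b) ^ 2) := add_sq_le
    _ = 2 * (cutoff n x ^ 2 * (a - b) ^ 2) + 2 * ((cutoff n x - cutoff n y) ^ 2 * b ^ 2) := by ring
    _ ≤ 2 * (1 * (a - b) ^ 2) + 2 * (min 1 (‖x - y‖ ^ 2) * b ^ 2) := by
        gcongr
        · exact pow_le_one₀ (cutoff_nonneg n x) (cutoff_le_one n x)
        · exact sq_cutoff_sub_le n x y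
    _ = 2 * (a - b) ^ 2 + 2 * (min 1 (‖x - y‖ ^ 2) * b ^ 2) := by rw [one_mul]

theorem cutoff_eq_zero [NormedSpace ℝ E] {n : ℕ} {x : E} (hx : x ∉ closedBall 0 (n + 1 : ℝ)) :
    cutoff n x = 0 := by
  rw [cutoff, thickenedIndicator_zero one_pos, NNReal.coe_zero]
  rw [thickening_closedBall one_pos n.cast_nonneg, add_comm]
  exact fun h => hx (ball_subset_closedBall h)

variable [MeasurableSpace E] [BorelSpace E]

theorem measurable_cutoff (n : ℕ) : Measurable (cutoff n : E → ℝ) :=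
  (lipschitzWith_cutoff n).continuous.measurable

theorem memLp_cutoff_mul {μ : Measure E} (n : ℕ) (u : Lp ℝ 2 μ) :
    MemLp (fun x => cutoff n x * u x) 2 μ := by
  refine (Lp.memLp u).mono ((measurable_cutoff n).mul (measurable_coeFn u)).aestronglyMeasurable
    (Eventually.of_forall fun x => ?_)
  rw [norm_mul, Real.norm_of_nonneg (cutoff_nonneg n x)]
  exact mul_le_of_le_one_left (norm_nonneg _) (cutoff_le_one n x)

/-- The compactly supported truncation of an `L²` function, its product with a cutoff. -/
def truncate {μ : Measure E} (n : ℕ) (u : Lp ℝ 2 μ) : Lp ℝ 2 μ :=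
  (memLp_cutoff_mul n u).toLp _

theorem coeFn_truncate {μ : Measure E} (n : ℕ) (u : Lp ℝ 2 μ) :
    truncate n u =ᵐ[μ] fun x => cutoff n x * u x :=
  (memLp_cutoff_mul n u).coeFn_toLp

theorem tendsto_truncate {μ : Measure E} (u : Lp ℝ 2 μ) :
    Tendsto (fun n => truncate n u) atTop (𝓝 u) := by
  have hlim : Tendsto (fun n => ∫⁻ x, ENNReal.ofReal (((cutoff n x - 1) * u x) ^ 2) ∂μ) atTop
      (𝓝 (∫⁻ _, 0 ∂μ)) := by
    refine tendsto_lintegral_of_dominated_convergence (fun x => ENNReal.ofReal (u x ^ 2))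
      (fun n => ?_) (fun n => Eventually.of_forall fun x => ENNReal.ofReal_le_ofReal ?_) ?_
      (Eventually.of_forall fun x => ?_)
    · have := measurable_cutoff (E := E) n
      have := measurable_coeFn u
      fun_prop
    · rw [mul_pow]
      refine mul_le_of_le_one_left (sq_nonneg _) (sq_le_one_iff_abs_le_one _ |>.2 (abs_le.2 ?_))
      constructor <;> linarith [cutoff_nonneg n x, cutoff_le_one n x]
    · rw [lintegral_sq_coeFn]
      exact ENNReal.ofReal_ne_top
    · simpa using ENNReal.tendsto_ofReal
        ((((tendsto_cutoff x).sub_const 1).mul_const (u x)).pow 2)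
  have hnorm (n : ℕ) : ∫⁻ x, ENNReal.ofReal (((cutoff n x - 1) * u x) ^ 2) ∂μ =
      ENNReal.ofReal (‖truncate n u - u‖ ^ 2) := by
    rw [← lintegral_sq_coeFn]
    refine lintegral_congr_ae ?_
    filter_upwards [Lp.coeFn_sub (truncate n u) u, coeFn_truncate n u] with x hsub htrunc
    rw [hsub, Pi.sub_apply, htrunc, sub_mul, one_mul]
  simp_rw [hnorm, lintegral_zero] at hlim
  have hsqrt := ((ENNReal.tendsto_toReal ENNReal.zero_ne_top).comp hlim).sqrt
  simp only [Function.comp_def, ENNReal.toReal_ofReal (sq_nonneg _), Real.sqrt_sq (norm_nonneg _),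
    ENNReal.toReal_zero, Real.sqrt_zero] at hsqrt
  exact tendsto_iff_norm_sub_tendsto_zero.2 hsqrt

end Cutoff

section GagliardoCutoff

variable {E : Type*} [NormedAddCommGroup E] [InnerProductSpace ℝ E]

theorem ofReal_sq_cutoff_mul_sub_div_le (n : ℕ) (f : E → ℝ) (p : E × E) :
    ENNReal.ofReal ((cutoff n (p.2 + p.1) * f (p.2 + p.1) - cutoff n p.2 * f p.2) ^ 2 /
        ‖p.1‖ ^ (finrank ℝ E + 1)) ≤
      2 * ENNReal.ofReal ((f (p.2 + p.1) - f p.2) ^ 2 / ‖p.1‖ ^ (finrank ℝ E + 1)) +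
        2 * (ENNReal.ofReal (min 1 (‖p.1‖ ^ 2) / ‖p.1‖ ^ (finrank ℝ E + 1)) *
          ENNReal.ofReal (f p.2 ^ 2)) := by
  rw [← ENNReal.ofReal_mul (by positivity), ← ENNReal.ofReal_ofNat 2,
    ← ENNReal.ofReal_mul zero_le_two, ← ENNReal.ofReal_mul zero_le_two,
    ← ENNReal.ofReal_add (by positivity) (by positivity)]
  refine ENNReal.ofReal_le_ofReal ?_
  have h := sq_cutoff_mul_sub_le n (p.2 + p.1) p.2 (f (p.2 + p.1)) (f p.2)
  rw [add_sub_cancel_left] at h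
  refine (div_le_div_of_nonneg_right h (by positivity)).trans_eq ?_
  ring

variable [FiniteDimensional ℝ E] [MeasurableSpace E] [BorelSpace E] [Nontrivial E]

theorem tendsto_gagliardo_truncate {u : Lp ℝ 2 (volume : Measure E)} (hu : gagliardo u ≠ ∞) :
    Tendsto (fun n => gagliardo (truncate n u)) atTop (𝓝 (gagliardo u)) := by
  have hmeas := measurable_coeFn u
  have hcutoff n := measurable_cutoff (E := E) n
  have htrunc (n : ℕ) : gagliardo (truncate n u) = ∫⁻ p : E × E, ENNReal.ofReal
      ((cutoff n (p.2 + p.1) * u (p.2 + p.1) - cutoff n p.2 * u p.2) ^ 2 /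
        ‖p.1‖ ^ (finrank ℝ E + 1)) := by
    rw [gagliardo_congr_ae (coeFn_truncate n u),
      gagliardo_eq_lintegral_prod (by fun_prop)]
  simp_rw [htrunc]
  rw [gagliardo_eq_lintegral_prod hmeas] at hu ⊢
  refine tendsto_lintegral_of_dominated_convergence _ (fun n => ?_)
    (fun n => Eventually.of_forall (ofReal_sq_cutoff_mul_sub_div_le n u)) ?_
    (Eventually.of_forall fun p => ?_)
  · fun_prop
  · rw [lintegral_add_left (by fun_prop), lintegral_const_mul' _ _ (by finiteness),
      lintegral_const_mul' _ _ (by finiteness), Measure.volume_eq_prod,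
      lintegral_prod_mul
        (f := fun h : E => ENNReal.ofReal (min 1 (‖h‖ ^ 2) / ‖h‖ ^ (finrank ℝ E + 1)))
        (g := fun x => ENNReal.ofReal (u x ^ 2)) (by fun_prop) (by fun_prop), lintegral_sq_coeFn]
    have hweight := integrable_min_one_sq_norm_div (E := E) |>.lintegral_lt_top.ne
    rw [Measure.volume_eq_prod] at hu
    finiteness
  · exact ENNReal.tendsto_ofReal (by
      simpa only [one_mul] using ((((tendsto_cutoff (p.2 + p.1)).mul_const _).sub
        ((tendsto_cutoff p.2).mul_const _)).pow 2).div_const _)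

theorem gagliardo_cutoff_ne_top (n : ℕ) : gagliardo (cutoff n : E → ℝ) ≠ ∞ := by
  set B := closedBall (0 : E) (n + 1)
  have hB : MeasurableSet B := measurableSet_closedBall
  have hpoint (h x : E) :
      ENNReal.ofReal ((cutoff n (x + h) - cutoff n x) ^ 2 / ‖h‖ ^ (finrank ℝ E + 1)) ≤
        ENNReal.ofReal (min 1 (‖h‖ ^ 2) / ‖h‖ ^ (finrank ℝ E + 1)) *
          (B.indicator 1 x + B.indicator 1 (x + h)) := by
    by_cases hx : x ∈ B ∨ x + h ∈ B
    · have hone : (1 : ℝ≥0∞) ≤ B.indicator 1 x + B.indicator 1 (x + h) := by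
        rcases hx with hx | hx <;> simp [hx]
      refine (ENNReal.ofReal_le_ofReal ?_).trans (le_mul_of_one_le_right' hone)
      have hsq := sq_cutoff_sub_le n (x + h) x
      rw [add_sub_cancel_left] at hsq
      gcongr
    · rw [not_or] at hx
      simp [cutoff_eq_zero hx.1, cutoff_eq_zero hx.2]
  have hshift (h : E) :
      ∫⁻ x, ENNReal.ofReal ((cutoff n (x + h) - cutoff n x) ^ 2 / ‖h‖ ^ (finrank ℝ E + 1)) ≤
        ENNReal.ofReal (min 1 (‖h‖ ^ 2) / ‖h‖ ^ (finrank ℝ E + 1)) * (2 * volume B) := by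
    refine (lintegral_mono (hpoint h)).trans_eq ?_
    rw [lintegral_const_mul' _ _ ENNReal.ofReal_ne_top,
      lintegral_add_left (measurable_one.indicator hB),
      lintegral_add_right_eq_self (fun x => B.indicator (1 : E → ℝ≥0∞) x) h,
      lintegral_indicator_one hB, two_mul]
  have hvol : volume B ≠ ∞ := measure_closedBall_lt_top.ne
  have hweight := integrable_min_one_sq_norm_div (E := E) |>.lintegral_lt_top.ne
  refine ne_top_of_le_ne_top ?_ (lintegral_mono hshift)
  rw [lintegral_mul_const' _ _ (by finiteness)]
  finiteness

theorem exists_gagliardo_ne_top :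
    ∃ u : Lp ℝ 2 (volume : Measure E), u ≠ 0 ∧ gagliardo u ≠ ∞ := by
  have hcont : Continuous (cutoff 0 : E → ℝ) := (lipschitzWith_cutoff 0).continuous
  have hmem : MemLp (cutoff 0 : E → ℝ) 2 volume :=
    hcont.memLp_of_hasCompactSupport (HasCompactSupport.intro
      (isCompact_closedBall 0 (↑(0 : ℕ) + 1)) fun x hx => cutoff_eq_zero hx)
  refine ⟨hmem.toLp _, fun h => ?_, ?_⟩
  · have hzero : (cutoff 0 : E → ℝ) =ᵐ[volume] fun _ => 0 :=
      (MemLp.toLp_eq_toLp_iff hmem MemLp.zero).1 h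
    have hone : cutoff 0 (0 : E) = 1 := cutoff_eq_one (by simp)
    rw [(hcont.ae_eq_iff_eq volume continuous_const).1 hzero] at hone
    exact zero_ne_one hone
  · rw [gagliardo_congr_ae hmem.coeFn_toLp]
    exact gagliardo_cutoff_ne_top 0

end GagliardoCutoff

section Dilation

variable {E : Type*} [NormedAddCommGroup E] [MeasureSpace E]

theorem eCoulomb_congr_ae {f f' g g' : E → ℝ} (hf : f =ᵐ[volume] f') (hg : g =ᵐ[volume] g') :
    eCoulomb f g = eCoulomb f' g' := by
  refine lintegral_congr_ae ?_
  filter_upwards [hg] with x hgx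
  refine lintegral_congr_ae ?_
  filter_upwards [hf] with y hfy
  rw [hfy, hgx]

theorem eCoulomb_const_mul (c : ℝ) (f g : E → ℝ) :
    eCoulomb (fun x => c * f x) (fun x => c * g x) = ENNReal.ofReal (c ^ 4) * eCoulomb f g := by
  have hc : 0 ≤ c ^ 4 := by positivity
  simp_rw [eCoulomb, ← lintegral_const_mul' _ _ ENNReal.ofReal_ne_top, ← ENNReal.ofReal_mul hc]
  refine lintegral_congr fun x => lintegral_congr fun y => ?_
  ring_nf

variable [NormedSpace ℝ E] [FiniteDimensional ℝ E] [BorelSpace E]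
  [(volume : Measure E).IsAddHaarMeasure] {t : ℝ}

theorem eCoulomb_comp_smul (f g : E → ℝ) (ht : 0 < t) :
    ENNReal.ofReal (t ^ finrank ℝ E) ^ 2 * eCoulomb (fun x => f (t • x)) (fun x => g (t • x)) =
      ENNReal.ofReal t * eCoulomb f g := by
  have hkernel (x y : E) : ENNReal.ofReal (f (t • y) ^ 2 / ‖x - y‖ * g (t • x) ^ 2) =
      ENNReal.ofReal t * ENNReal.ofReal (f (t • y) ^ 2 / ‖t • x - t • y‖ * g (t • x) ^ 2) := by
    rw [← ENNReal.ofReal_mul ht.le, ← smul_sub, norm_smul, Real.norm_of_nonneg ht.le]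
    field_simp
  have hinner (x : E) : ∫⁻ y, ENNReal.ofReal (f (t • y) ^ 2 / ‖x - y‖ * g (t • x) ^ 2) =
      ENNReal.ofReal t * (ENNReal.ofReal (t ^ finrank ℝ E)⁻¹ *
        ∫⁻ y, ENNReal.ofReal (f y ^ 2 / ‖t • x - y‖ * g (t • x) ^ 2)) := by
    simp_rw [hkernel]
    rw [lintegral_const_mul' _ _ ENNReal.ofReal_ne_top, lintegral_comp_smul volume
      (fun y => ENNReal.ofReal (f y ^ 2 / ‖t • x - y‖ * g (t • x) ^ 2)) ht]
  have hcancel : ENNReal.ofReal (t ^ finrank ℝ E) * ENNReal.ofReal (t ^ finrank ℝ E)⁻¹ = 1 := by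
    rw [← ENNReal.ofReal_mul (by positivity), mul_inv_cancel₀ (by positivity), ENNReal.ofReal_one]
  simp_rw [eCoulomb, hinner]
  rw [lintegral_const_mul' _ _ ENNReal.ofReal_ne_top,
    lintegral_const_mul' _ _ ENNReal.ofReal_ne_top, lintegral_comp_smul volume
      (fun x => ∫⁻ y, ENNReal.ofReal (f y ^ 2 / ‖x - y‖ * g x ^ 2)) ht]
  generalize ENNReal.ofReal (t ^ finrank ℝ E) = a at hcancel ⊢
  generalize ENNReal.ofReal (t ^ finrank ℝ E)⁻¹ = b at hcancel ⊢
  generalize ∫⁻ x, ∫⁻ y, ENNReal.ofReal (f y ^ 2 / ‖x - y‖ * g x ^ 2) = I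
  calc a ^ 2 * (ENNReal.ofReal t * (b * (b * I)))
      = (a * b) ^ 2 * (ENNReal.ofReal t * I) := by ring
    _ = ENNReal.ofReal t * I := by rw [hcancel, one_pow, one_mul]

theorem ae_comp_smul {p : E → Prop} (hp : ∀ᵐ x, p x) (ht : 0 < t) : ∀ᵐ x, p (t • x) := by
  have hmap : Measure.map (t • ·) (volume : Measure E) ≪ volume := by
    rw [Measure.map_addHaar_smul _ ht.ne']
    exact Measure.smul_absolutelyContinuous
  exact ae_of_ae_map (measurable_const_smul t).aemeasurable (hmap.ae_le hp)

theorem lintegral_sq_dilate (ht : 0 < t) (f : E → ℝ) :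
    ∫⁻ x, ENNReal.ofReal ((√(t ^ finrank ℝ E) * f (t • x)) ^ 2) =
      ∫⁻ x, ENNReal.ofReal (f x ^ 2) := by
  have hpow : 0 < t ^ finrank ℝ E := by positivity
  simp_rw [mul_pow, Real.sq_sqrt hpow.le, ENNReal.ofReal_mul hpow.le]
  rw [lintegral_const_mul' _ _ ENNReal.ofReal_ne_top,
    lintegral_comp_smul volume (fun x => ENNReal.ofReal (f x ^ 2)) ht, ← mul_assoc,
    ← ENNReal.ofReal_mul hpow.le, mul_inv_cancel₀ hpow.ne', ENNReal.ofReal_one, one_mul]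

theorem memLp_dilate (ht : 0 < t) (u : Lp ℝ 2 (volume : Measure E)) :
    MemLp (fun x => √(t ^ finrank ℝ E) * u (t • x)) 2 volume := by
  have hmeas : Measurable fun x => √(t ^ finrank ℝ E) * u (t • x) :=
    ((measurable_coeFn u).comp (measurable_const_smul t)).const_mul _
  rw [memLp_two_iff_integrable_sq hmeas.aestronglyMeasurable,
    ← lintegral_ofReal_ne_top_iff_integrable (hmeas.pow_const 2).aestronglyMeasurable
      (Eventually.of_forall fun _ => sq_nonneg _), lintegral_sq_dilate ht, lintegral_sq_coeFn]
  exact ENNReal.ofReal_ne_top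

/-- The mass-preserving dilation `u ↦ t^{d/2} u(t ·)` of `L²(E)`, where `d = dim E`. -/
def dilate (ht : 0 < t) (u : Lp ℝ 2 (volume : Measure E)) : Lp ℝ 2 (volume : Measure E) :=
  (memLp_dilate ht u).toLp _

theorem coeFn_dilate (ht : 0 < t) (u : Lp ℝ 2 (volume : Measure E)) :
    dilate ht u =ᵐ[volume] fun x => √(t ^ finrank ℝ E) * u (t • x) :=
  (memLp_dilate ht u).coeFn_toLp

theorem norm_dilate (ht : 0 < t) (u : Lp ℝ 2 (volume : Measure E)) : ‖dilate ht u‖ = ‖u‖ := by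
  have h : ENNReal.ofReal (‖dilate ht u‖ ^ 2) = ENNReal.ofReal (‖u‖ ^ 2) := by
    rw [← lintegral_sq_coeFn, ← lintegral_sq_coeFn, ← lintegral_sq_dilate ht u]
    exact lintegral_congr_ae ((coeFn_dilate ht u).mono fun x hx => by simp only [hx])
  rwa [ENNReal.ofReal_eq_ofReal_iff (sq_nonneg _) (sq_nonneg _),
    pow_left_inj₀ (norm_nonneg _) (norm_nonneg _) two_ne_zero] at h

theorem eCoulomb_dilate (ht : 0 < t) (u v : Lp ℝ 2 (volume : Measure E)) :
    eCoulomb (dilate ht u) (dilate ht v) = ENNReal.ofReal t * eCoulomb u v := by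
  have hpow : 0 ≤ t ^ finrank ℝ E := by positivity
  rw [eCoulomb_congr_ae (coeFn_dilate ht u) (coeFn_dilate ht v), eCoulomb_const_mul,
    ← eCoulomb_comp_smul u v ht, ← ENNReal.ofReal_pow hpow]
  congr 2
  rw [show 4 = 2 * 2 from rfl, pow_mul, Real.sq_sqrt hpow]

end Dilation

section GagliardoDilation

variable {E : Type*} [NormedAddCommGroup E] [InnerProductSpace ℝ E] [FiniteDimensional ℝ E]
  [MeasurableSpace E] [BorelSpace E] {t : ℝ}

theorem gagliardo_dilate (ht : 0 < t) (u : Lp ℝ 2 (volume : Measure E)) :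
    gagliardo (dilate ht u) = ENNReal.ofReal t * gagliardo u := by
  rw [gagliardo_congr_ae (coeFn_dilate ht u),
    gagliardo_const_mul (√(t ^ finrank ℝ E)) fun x => u (t • x),
    Real.sq_sqrt (by positivity), gagliardo_comp_smul _ ht]

end GagliardoDilation

section Scaling

variable {t : ℝ}

theorem MemHHalf.dilate (ht : 0 < t) {u : L2} (hu : MemHHalf u) : MemHHalf (dilate ht u) := by
  rw [memHHalf_iff_gagliardo_ne_top] at hu ⊢
  rw [gagliardo_dilate]
  finiteness

theorem quarterLaplacianSq_dilate (ht : 0 < t) (u : L2) :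
    quarterLaplacianSq (dilate ht u) = t * quarterLaplacianSq u := by
  rw [quarterLaplacianSq_eq, quarterLaplacianSq_eq, gagliardo_dilate, ENNReal.toReal_mul,
    ENNReal.toReal_ofReal ht.le, mul_div_assoc]

theorem coulomb_dilate (ht : 0 < t) {u : L2} (hu : MemHHalf u) (v : L2) :
    coulomb (dilate ht u) (dilate ht v) = t * coulomb u v := by
  rw [coulomb_eq_toReal (hu.dilate ht), coulomb_eq_toReal hu, eCoulomb_dilate, ENNReal.toReal_mul,
    ENNReal.toReal_ofReal ht.le]

end Scaling

section TestFunction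

variable {V : R3 → ℝ} {m R t : ℝ} {u : L2}

/-- `u` vanishes almost everywhere outside the closed ball of radius `R` around the origin. -/
def SupportedIn (R : ℝ) (u : L2) : Prop := ∀ᵐ x, x ∉ closedBall 0 R → u x = 0

theorem supportedIn_truncate (n : ℕ) (u : L2) : SupportedIn (n + 1) (truncate n u) := by
  filter_upwards [coeFn_truncate n u] with x hx hxR
  rw [hx, cutoff_eq_zero hxR, zero_mul]

theorem SupportedIn.const_smul (hu : SupportedIn R u) (c : ℝ) : SupportedIn R (c • u) := by
  filter_upwards [hu, Lp.coeFn_smul c u] with x hx hsmul hxR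
  rw [hsmul, Pi.smul_apply, hx hxR, smul_zero]

theorem SupportedIn.dilate (hu : SupportedIn R u) (ht : 1 ≤ t) :
    SupportedIn R (dilate (one_pos.trans_le ht) u) := by
  have ht₀ : 0 < t := one_pos.trans_le ht
  filter_upwards [coeFn_dilate ht₀ u, ae_comp_smul hu ht₀] with x hx hsupp hxR
  rw [hx, hsupp, mul_zero]
  rw [mem_closedBall_zero_iff, not_le] at hxR ⊢
  rw [norm_smul, Real.norm_of_nonneg ht₀.le]
  exact hxR.trans_le (le_mul_of_one_le_left (norm_nonneg x) ht)

theorem IsTrapping.exists_ae_norm_le (hV : IsTrapping V) (R : ℝ) :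
    ∃ S : ℝ, ∀ᵐ x ∂volume.restrict (closedBall 0 R), ‖V x‖ ≤ S := by
  have hmem := hV.locBounded _ (isCompact_closedBall 0 R)
  refine ⟨(eLpNorm V ∞ (volume.restrict (closedBall 0 R))).toReal, ?_⟩
  filter_upwards [ae_le_eLpNormEssSup (f := V) (μ := volume.restrict (closedBall 0 R))] with x hx
  rw [← toReal_enorm, eLpNorm_exponent_top]
  exact ENNReal.toReal_mono (by simpa only [eLpNorm_exponent_top] using hmem.2.ne) hx

theorem IsTrapping.exists_potentialTerm_le (hV : IsTrapping V) (R : ℝ) :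
    ∃ S : ℝ, ∀ u, SupportedIn R u →
      Integrable (fun x => V x * u x ^ 2) ∧ potentialTerm V u ≤ S * ‖u‖ ^ 2 := by
  obtain ⟨S, hS⟩ := hV.exists_ae_norm_le R
  have hball : MeasurableSet (closedBall (0 : R3) R) := measurableSet_closedBall
  have hmem := hV.locBounded _ (isCompact_closedBall 0 R)
  refine ⟨S, fun u hu => ?_⟩
  have hbound : ∀ᵐ x, V x * u x ^ 2 ≤ S * u x ^ 2 := by
    filter_upwards [hu, (ae_restrict_iff' hball).1 hS] with x hux hVx
    by_cases hx : x ∈ closedBall 0 R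
    · exact mul_le_mul_of_nonneg_right ((le_abs_self _).trans (hVx hx)) (sq_nonneg _)
    · simp [hux hx]
  have hint : Integrable fun x => V x * u x ^ 2 := by
    have hon : IntegrableOn (fun x => V x * u x ^ 2) (closedBall 0 R) :=
      (integrable_sq_coeFn u).integrableOn.bdd_mul hmem.1 hS
    refine hon.integrable_of_ae_notMem_eq_zero ?_
    filter_upwards [hu] with x hux hx
    rw [hux hx, zero_pow two_ne_zero, mul_zero]
  refine ⟨hint, ?_⟩
  rw [potentialTerm, ← integral_sq_coeFn, ← integral_const_mul]
  exact integral_mono_ae hint ((integrable_sq_coeFn u).const_mul S) hbound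

/-- An admissible trial state for every trapping potential: a normalized `H^{1/2}` function with
bounded support. -/
structure IsTestFunction (u : L2) : Prop where
  memHHalf : MemHHalf u
  norm_eq_one : ‖u‖ = 1
  exists_supportedIn : ∃ R, SupportedIn R u

theorem exists_seq_isTestFunction (hu : MemHHalf u) (hnorm : ‖u‖ = 1) :
    ∃ v : ℕ → L2, (∀ n, IsTestFunction (v n)) ∧ Tendsto v atTop (𝓝 u) ∧
      Tendsto (fun n => gagliardo (v n)) atTop (𝓝 (gagliardo u)) := by
  rw [memHHalf_iff_gagliardo_ne_top] at hu
  have htrunc := tendsto_truncate u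
  have hgag := tendsto_gagliardo_truncate hu
  have hinv : Tendsto (fun n => ‖truncate n u‖⁻¹) atTop (𝓝 1) := by
    simpa only [hnorm, inv_one] using htrunc.norm.inv₀ (by rw [hnorm]; exact one_ne_zero)
  obtain ⟨N, hN⟩ := eventually_atTop.1
    ((htrunc.eventually_ne (norm_ne_zero_iff.1 (hnorm.trans_ne one_ne_zero))).and
      (hgag.eventually_ne hu))
  refine ⟨fun n => ‖truncate (n + N) u‖⁻¹ • truncate (n + N) u, fun n => ⟨?_, ?_, ?_⟩, ?_, ?_⟩
  · rw [memHHalf_iff_gagliardo_ne_top, gagliardo_coeFn_smul]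
    exact ENNReal.mul_ne_top ENNReal.ofReal_ne_top (hN _ (Nat.le_add_left N n)).2
  · exact norm_smul_inv_norm (𝕜 := ℝ) (hN _ (Nat.le_add_left N n)).1
  · exact ⟨_, (supportedIn_truncate (n + N) u).const_smul _⟩
  · have hsmul := hinv.smul htrunc
    rw [one_smul] at hsmul
    exact hsmul.comp (tendsto_add_atTop_nat N)
  · simp_rw [gagliardo_coeFn_smul]
    have hmul := ENNReal.Tendsto.mul (ENNReal.tendsto_ofReal (hinv.pow 2)) (.inr hu) hgag
      (.inr ENNReal.ofReal_ne_top)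
    rw [one_pow, ENNReal.ofReal_one, one_mul] at hmul
    exact hmul.comp (tendsto_add_atTop_nat N)

theorem exists_isTestFunction : ∃ u, IsTestFunction u := by
  obtain ⟨u, hu₀, hu⟩ := exists_gagliardo_ne_top (E := R3)
  have hnormalized : MemHHalf (‖u‖⁻¹ • u) := by
    rw [memHHalf_iff_gagliardo_ne_top, gagliardo_coeFn_smul]
    finiteness
  obtain ⟨v, hv, -⟩ := exists_seq_isTestFunction hnormalized (norm_smul_inv_norm (𝕜 := ℝ) hu₀)
  exact ⟨v 0, hv 0⟩

theorem IsTestFunction.mem_trapSpace (hu : IsTestFunction u) (hV : IsTrapping V) :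
    u ∈ trapSpace V := by
  obtain ⟨R, hR⟩ := hu.exists_supportedIn
  obtain ⟨S, hS⟩ := hV.exists_potentialTerm_le R
  exact ⟨hu.memHHalf, (hS u hR).1⟩

theorem IsTestFunction.dilate (hu : IsTestFunction u) (ht : 1 ≤ t) :
    IsTestFunction (dilate (one_pos.trans_le ht) u) where
  memHHalf := hu.memHHalf.dilate _
  norm_eq_one := (norm_dilate _ u).trans hu.norm_eq_one
  exists_supportedIn := hu.exists_supportedIn.imp fun _ hR => hR.dilate ht

theorem IsTestFunction.mem_constraintSet {V₁ V₂ : R3 → ℝ} {v : L2} (hu : IsTestFunction u)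
    (hv : IsTestFunction v) (hV₁ : IsTrapping V₁) (hV₂ : IsTrapping V₂) :
    (u, v) ∈ constraintSet V₁ V₂ :=
  ⟨hu.mem_trapSpace hV₁, hv.mem_trapSpace hV₂, (integral_sq_eq_one_iff u).2 hu.norm_eq_one,
    (integral_sq_eq_one_iff v).2 hv.norm_eq_one⟩

theorem IsTestFunction.exists_trapEnergy_dilate_le (hu : IsTestFunction u) (hV : IsTrapping V) :
    ∃ S, ∀ t (ht : 1 ≤ t),
      trapEnergy m V (PseudoHartree.dilate (one_pos.trans_le ht) u) ≤
        t * quarterLaplacianSq u + S := by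
  obtain ⟨R, hR⟩ := hu.exists_supportedIn
  obtain ⟨S, hS⟩ := hV.exists_potentialTerm_le R
  refine ⟨|m| + S, fun t ht => ?_⟩
  have hkinetic := kinetic_le m (hu.dilate ht).memHHalf
  have hpotential := (hS _ (hR.dilate ht)).2
  rw [quarterLaplacianSq_dilate, (hu.dilate ht).norm_eq_one] at hkinetic
  rw [(hu.dilate ht).norm_eq_one] at hpotential
  rw [trapEnergy]
  linarith

end TestFunction

section Collapse

variable {m a₁ a₂ β : ℝ} {V₁ V₂ : R3 → ℝ} {u v : L2}

theorem coulomb_le (hu : MemHHalf u) (v : L2) :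
    coulomb u v ≤ (hardyConst R3 * gagliardo u).toReal * ‖v‖ ^ 2 := by
  rw [← integral_sq_coeFn, ← integral_const_mul]
  exact integral_mono (integrable_phi_mul_sq hu v) ((integrable_sq_coeFn v).const_mul _)
    fun x => mul_le_mul_of_nonneg_right (phi_le hu x) (sq_nonneg _)

theorem eHat_eq_bot_of_energy_le {A d : ℝ} (hd : 0 < d)
    (h : ∀ t ≥ 1, ∃ w ∈ constraintSet V₁ V₂, energy m V₁ V₂ a₁ a₂ β w ≤ A - t * d) :
    eHat m V₁ V₂ a₁ a₂ β = ⊥ := by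
  refine (EReal.eq_bot_iff_forall_lt _).2 fun y => ?_
  obtain ⟨t, hty, ht⟩ :=
    ((tendsto_id.atTop_mul_const hd |>.eventually_gt_atTop (A - y)).and
      (eventually_ge_atTop 1)).exists
  obtain ⟨w, hw, hle⟩ := h t ht
  rw [id_eq] at hty
  exact (iInf₂_le w hw).trans_lt (EReal.coe_lt_coe (by linarith))

theorem eHat_le_eHat_swap : eHat m V₁ V₂ a₁ a₂ β ≤ eHat m V₂ V₁ a₂ a₁ β := by
  refine le_iInf₂ fun w hw => ?_
  refine (iInf₂_le w.swap ⟨hw.2.1, hw.1, hw.2.2.2, hw.2.2.1⟩).trans_eq ?_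
  simp only [energy, Prod.fst_swap, Prod.snd_swap, coulomb_comm hw.1.1 hw.2.1.1]
  congr 1
  ring

theorem tendsto_quarterLaplacianSq {w : ℕ → L2} (hu : MemHHalf u)
    (h : Tendsto (fun n => gagliardo (w n)) atTop (𝓝 (gagliardo u))) :
    Tendsto (fun n => quarterLaplacianSq (w n)) atTop (𝓝 (quarterLaplacianSq u)) := by
  simp_rw [quarterLaplacianSq_eq]
  exact ((ENNReal.tendsto_toReal ((memHHalf_iff_gagliardo_ne_top u).1 hu)).comp h).div_const _

theorem tendsto_coulomb_of_tendsto_gagliardo {w z : ℕ → L2} (hu : MemHHalf u) (hv : MemHHalf v)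
    (hw : Tendsto w atTop (𝓝 u)) (hz : Tendsto z atTop (𝓝 v))
    (h : Tendsto (fun n => gagliardo (w n)) atTop (𝓝 (gagliardo u))) :
    Tendsto (fun n => coulomb (w n) (z n)) atTop (𝓝 (coulomb u v)) := by
  have hfinite := (memHHalf_iff_gagliardo_ne_top u).1 hu
  exact tendsto_coulomb hw hz (ENNReal.add_ne_top.2 ⟨hfinite, ENNReal.one_ne_top⟩)
    ((h.eventually_lt_const (ENNReal.lt_add_right hfinite one_ne_zero)).mono fun _ => le_of_lt)
    hu hv

theorem eHat_eq_bot_of_isTestFunction (hV₁ : IsTrapping V₁) (hV₂ : IsTrapping V₂)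
    (hu : IsTestFunction u) (hv : IsTestFunction v)
    (h : 2 * quarterLaplacianSq u + 2 * quarterLaplacianSq v <
      a₁ * coulomb u u + a₂ * coulomb v v + 2 * β * coulomb u v) :
    eHat m V₁ V₂ a₁ a₂ β = ⊥ := by
  obtain ⟨S, hS⟩ := hu.exists_trapEnergy_dilate_le (m := m) hV₁
  obtain ⟨T, hT⟩ := hv.exists_trapEnergy_dilate_le (m := m) hV₂
  refine eHat_eq_bot_of_energy_le (A := S + T) (half_pos (sub_pos.2 h)) fun t ht =>
    ⟨_, (hu.dilate ht).mem_constraintSet (hv.dilate ht) hV₁ hV₂, ?_⟩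
  have hSt := hS t ht
  have hTt := hT t ht
  rw [trapEnergy] at hSt hTt
  simp only [energy, coulomb_dilate _ hu.memHHalf, coulomb_dilate _ hv.memHHalf]
  linarith

theorem eHat_eq_bot_of_pair (hV₁ : IsTrapping V₁) (hV₂ : IsTrapping V₂)
    (hu : MemHHalf u) (hu₁ : ‖u‖ = 1) (hv : MemHHalf v) (hv₁ : ‖v‖ = 1)
    (h : 2 * quarterLaplacianSq u + 2 * quarterLaplacianSq v <
      a₁ * coulomb u u + a₂ * coulomb v v + 2 * β * coulomb u v) :
    eHat m V₁ V₂ a₁ a₂ β = ⊥ := by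
  obtain ⟨w, hw, hwu, hwgag⟩ := exists_seq_isTestFunction hu hu₁
  obtain ⟨z, hz, hzv, hzgag⟩ := exists_seq_isTestFunction hv hv₁
  have hkinetic := ((tendsto_quarterLaplacianSq hu hwgag).const_mul 2).add
    ((tendsto_quarterLaplacianSq hv hzgag).const_mul 2)
  have hcoulomb := (((tendsto_coulomb_of_tendsto_gagliardo hu hu hwu hwu hwgag).const_mul a₁).add
    ((tendsto_coulomb_of_tendsto_gagliardo hv hv hzv hzv hzgag).const_mul a₂)).add
    ((tendsto_coulomb_of_tendsto_gagliardo hu hv hwu hzv hwgag).const_mul (2 * β))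
  obtain ⟨n, hn⟩ := (hkinetic.eventually_lt hcoulomb h).exists
  exact eHat_eq_bot_of_isTestFunction hV₁ hV₂ (hw n) (hz n) hn

theorem eHat_eq_bot_of_single_isTestFunction (hV₁ : IsTrapping V₁) (hV₂ : IsTrapping V₂)
    (hu : IsTestFunction u) (h : 2 * quarterLaplacianSq u < a₁ * coulomb u u) :
    eHat m V₁ V₂ a₁ a₂ β = ⊥ := by
  obtain ⟨z, hz⟩ := exists_isTestFunction
  obtain ⟨S, hS⟩ := hu.exists_trapEnergy_dilate_le (m := m) hV₁
  set K := (hardyConst R3 * gagliardo z).toReal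
  refine eHat_eq_bot_of_energy_le
    (A := S + trapEnergy m V₂ z - a₂ / 2 * coulomb z z + |β| * K)
    (half_pos (sub_pos.2 h)) fun t ht => ⟨_, (hu.dilate ht).mem_constraintSet hz hV₁ hV₂, ?_⟩
  have hSt := hS t ht
  set u' := dilate (one_pos.trans_le ht) u with hu'
  have hcross : -β * coulomb u' z ≤ |β| * K := by
    have hle := coulomb_le hz.memHHalf u'
    rw [hu', (hu.dilate ht).norm_eq_one, one_pow, mul_one] at hle
    rw [coulomb_comm (hu.dilate ht).memHHalf hz.memHHalf]
    exact mul_le_mul (neg_le_abs β) hle (coulomb_nonneg _ _) (abs_nonneg β)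
  have hself : coulomb u' u' = t * coulomb u u := coulomb_dilate _ hu.memHHalf u
  rw [trapEnergy] at hSt
  simp only [energy, trapEnergy, hself]
  linarith

theorem eHat_eq_bot_of_single (hV₁ : IsTrapping V₁) (hV₂ : IsTrapping V₂)
    (hu : MemHHalf u) (hu₁ : ‖u‖ = 1) (h : 2 * quarterLaplacianSq u < a₁ * coulomb u u) :
    eHat m V₁ V₂ a₁ a₂ β = ⊥ := by
  obtain ⟨w, hw, hwu, hgag⟩ := exists_seq_isTestFunction hu hu₁
  obtain ⟨n, hn⟩ := (((tendsto_quarterLaplacianSq hu hgag).const_mul 2).eventually_lt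
    ((tendsto_coulomb_of_tendsto_gagliardo hu hu hwu hwu hgag).const_mul a₁) h).exists
  exact eHat_eq_bot_of_single_isTestFunction hV₁ hV₂ (hw n) hn

theorem exists_lt_of_eta_lt_one (ha₁ : 0 ≤ a₁) (ha₂ : 0 ≤ a₂) (ha : 0 < a₁ + a₂ + max 0 β)
    (hη : eta a₁ a₂ β < 1) :
    ∃ u v : L2, (MemHHalf u ∧ ‖u‖ = 1) ∧ (MemHHalf v ∧ ‖v‖ = 1) ∧
      2 * quarterLaplacianSq u + 2 * quarterLaplacianSq v <
        a₁ * coulomb u u + a₂ * coulomb v v + 2 * max 0 β * coulomb u v := by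
  simp only [eta, iInf_lt_iff] at hη
  obtain ⟨⟨u, v⟩, ⟨hu, hv, hu₁, hv₁⟩, hJ⟩ := hη
  rw [integral_sq_eq_one_iff] at hu₁ hv₁
  have hu₀ : u ≠ 0 := norm_ne_zero_iff.1 (hu₁.trans_ne one_ne_zero)
  have hv₀ : v ≠ 0 := norm_ne_zero_iff.1 (hv₁.trans_ne one_ne_zero)
  have hD : 0 < a₁ * coulomb u u + a₂ * coulomb v v + 2 * max 0 β * coulomb u v := by
    have huu := coulomb_pos hu hu₀ hu₀
    have hvv := coulomb_pos hv hv₀ hv₀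
    have huv := coulomb_pos hu hu₀ hv₀
    rcases ha₁.eq_or_lt with rfl | ha₁
    · rcases ha₂.eq_or_lt with rfl | ha₂
      · rw [zero_add, zero_add] at ha
        positivity
      · positivity
    · positivity
  exact ⟨u, v, ⟨hu, hu₁⟩, ⟨hv, hv₁⟩, (div_lt_one hD).1 (mod_cast hJ)⟩

theorem eHat_eq_bot_of_eta_lt_one (hV₁ : IsTrapping V₁) (hV₂ : IsTrapping V₂) (ha₁ : 0 ≤ a₁)
    (ha₂ : 0 ≤ a₂) (ha : 0 < a₁ + a₂ + max 0 β) (hη : eta a₁ a₂ β < 1) :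
    eHat m V₁ V₂ a₁ a₂ β = ⊥ := by
  obtain ⟨u, v, ⟨hu, hu₁⟩, ⟨hv, hv₁⟩, h⟩ := exists_lt_of_eta_lt_one ha₁ ha₂ ha hη
  rcases le_total 0 β with hβ | hβ
  · rw [max_eq_right hβ] at h
    exact eHat_eq_bot_of_pair hV₁ hV₂ hu hu₁ hv hv₁ h
  · rw [max_eq_left hβ, mul_zero, zero_mul, add_zero] at h
    rcases lt_or_lt_of_add_lt_add h with h | h
    · exact eHat_eq_bot_of_single hV₁ hV₂ hu hu₁ h
    · exact eq_bot_iff.2 (eHat_le_eHat_swap.trans_eq (eHat_eq_bot_of_single hV₂ hV₁ hv hv₁ h))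

theorem not_exists_isMinimizer_of_eHat_eq_bot (h : eHat m V₁ V₂ a₁ a₂ β = ⊥) :
    ¬ ∃ w, IsMinimizer m V₁ V₂ a₁ a₂ β w := by
  rintro ⟨w, -, hw⟩
  exact EReal.coe_ne_bot _ (hw.trans h)

theorem constraintSet_nonempty (hV₁ : IsTrapping V₁) (hV₂ : IsTrapping V₂) :
    (constraintSet V₁ V₂).Nonempty := by
  obtain ⟨u, hu⟩ := exists_isTestFunction
  exact ⟨(u, u), hu.mem_constraintSet hu hV₁ hV₂⟩

end Collapse

end PseudoHartree

end

theorem theorem2p1_general (m : ℝ) (V₁ V₂ : PseudoHartree.R3 → ℝ)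
    (hV₁ : PseudoHartree.IsTrapping V₁) (hV₂ : PseudoHartree.IsTrapping V₂)
    (a₁ a₂ β : ℝ) (ha₁ : 0 ≤ a₁) (ha₂ : 0 ≤ a₂) (ha : 0 < a₁ + a₂ + max 0 β) :
    (1 < PseudoHartree.eta a₁ a₂ β →
      ∃ w : PseudoHartree.L2 × PseudoHartree.L2,
        PseudoHartree.IsMinimizer m V₁ V₂ a₁ a₂ β w) ∧
    (PseudoHartree.eta a₁ a₂ β < 1 →
      ¬ ∃ w : PseudoHartree.L2 × PseudoHartree.L2,
        PseudoHartree.IsMinimizer m V₁ V₂ a₁ a₂ β w) :=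
  ⟨fun hη => PseudoHartree.exists_isMinimizer hV₁ hV₂ hη
      (PseudoHartree.constraintSet_nonempty hV₁ hV₂),
    fun hη => PseudoHartree.not_exists_isMinimizer_of_eHat_eq_bot
      (PseudoHartree.eHat_eq_bot_of_eta_lt_one hV₁ hV₂ ha₁ ha₂ ha hη)⟩

theorem theorem2p1 (m : ℝ) (hm : 0 < m) (V₁ V₂ : PseudoHartree.R3 → ℝ)
    (hV₁ : PseudoHartree.IsTrapping V₁) (hV₂ : PseudoHartree.IsTrapping V₂)
    (a₁ a₂ β : ℝ) (ha₁ : 0 < a₁) (ha₂ : 0 < a₂) :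
    (1 < PseudoHartree.eta a₁ a₂ β →
      ∃ w : PseudoHartree.L2 × PseudoHartree.L2,
        PseudoHartree.IsMinimizer m V₁ V₂ a₁ a₂ β w) ∧
    (PseudoHartree.eta a₁ a₂ β < 1 →
      ¬ ∃ w : PseudoHartree.L2 × PseudoHartree.L2,
        PseudoHartree.IsMinimizer m V₁ V₂ a₁ a₂ β w) :=
  theorem2p1_general m V₁ V₂ hV₁ hV₂ a₁ a₂ β ha₁.le ha₂.le
    (add_pos_of_pos_of_nonneg (add_pos ha₁ ha₂) (le_max_left 0 β))
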